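/- Let $\mathbb{K}$ be an algebraically closed field of characteristic zero. An affine monoid is an irreducible normal affine algebraic variety $X$ over $\mathbb{K}$ with an associative multiplication $X\times X\to X$, $(x,y)\mapsto x*y$, that is a morphism of varieties and has a unity $1\in X$. Its group of invertible elements $G(X)$ is an affine algebraic group, Zariski open in $X$; the corank of $X$ is the codimension of a maximal torus in $G(X)$. Let $Z(X)=\{x\in X : x*y=y*x \text{ for all } y\in X\}$ be the center of $X$. Let $X$ be an affine monoid of corank one. If $X$ is noncommutative, then $$\dim Z(X)=\dim X-2 .$$ -/

import Mathlib

open scoped TensorProduct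

/-- The set of (closed) points of the affine variety over `K` with coordinate algebra `A`:
the `K`-algebra homomorphisms `A → K`. -/
def AffinePoint (K A : Type*) [Field K] [CommRing A] [Algebra K A] : Type _ := A →ₐ[K] K

namespace AffinePoint

variable {K A : Type*} [Field K] [CommRing A] [Algebra K A]

/-- The point, viewed as an algebra homomorphism. -/
def toAlgHom (x : AffinePoint K A) : A →ₐ[K] K := x

/-- The value at the point `x` of the regular function `f`. -/
instance : CoeFun (AffinePoint K A) (fun _ => A → K) := ⟨fun x f => x.toAlgHom f⟩

/-- The maximal ideal of functions vanishing at a point, as an element of the spectrum. -/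
def toPrimeSpectrum (x : AffinePoint K A) : PrimeSpectrum A :=
  ⟨RingHom.ker x.toAlgHom, RingHom.ker_isPrime x.toAlgHom⟩

/-- The Zariski topology on the set of points. -/
instance : TopologicalSpace (AffinePoint K A) :=
  TopologicalSpace.induced toPrimeSpectrum inferInstance

/-- The closed sets are the zero loci of sets of regular functions. -/
theorem isClosed_iff_zeroLocus (C : Set (AffinePoint K A)) :
    IsClosed C ↔ ∃ S : Set A, C = {x | ∀ f ∈ S, x f = 0} := by
  rw [isClosed_induced_iff]
  constructor
  · rintro ⟨t, ht, rfl⟩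
    obtain ⟨S, rfl⟩ := (PrimeSpectrum.isClosed_iff_zeroLocus t).1 ht
    exact ⟨S, rfl⟩
  · rintro ⟨S, rfl⟩
    exact ⟨PrimeSpectrum.zeroLocus S, PrimeSpectrum.isClosed_zeroLocus S, rfl⟩

end AffinePoint

/-- The monoid multiplication `X × X → X` on the points of the affine variety `X` with coordinate
algebra `A` is a morphism of varieties: it pulls back every regular function on `X` to a regular
function on `X × X`, i.e. to a function given by an element of `A ⊗ A`. -/
def MulIsMorphism (K A : Type*) [Field K] [CommRing A] [Algebra K A]
    [Monoid (AffinePoint K A)] : Prop :=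
  ∀ f : A, ∃ F : A ⊗[K] A, ∀ x y : AffinePoint K A,
    (x * y) f = Algebra.TensorProduct.productMap x.toAlgHom y.toAlgHom F

/-- The algebra of regular functions on the standard torus `(Kˣ)^r`: the functions given by Laurent
polynomials in the coordinates. -/
def laurentFunctions (K : Type*) [Field K] (r : ℕ) : Subalgebra K ((Fin r → Kˣ) → K) :=
  Algebra.adjoin K
    (Set.range (fun (i : Fin r) (t : Fin r → Kˣ) => ((t i : Kˣ) : K)) ∪
      Set.range (fun (i : Fin r) (t : Fin r → Kˣ) => (((t i)⁻¹ : Kˣ) : K)))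

section Corank

variable {K A : Type*} [Field K] [CommRing A] [Algebra K A] [Monoid (AffinePoint K A)]

/-- A function on a subgroup `T` of the group of invertible elements is regular if locally, in the
Zariski topology of `T`, it is a quotient of two regular functions on `X`. -/
def IsRegularOnSubgroup (T : Subgroup (AffinePoint K A)ˣ) (φ : T → K) : Prop :=
  ∀ g : T, ∃ a b : A, g.1.1 b ≠ 0 ∧ ∀ h : T, h.1.1 b ≠ 0 → φ h = h.1.1 a / h.1.1 b

/-- `T` is an `r`-dimensional torus in the group `G(X)` of invertible elements: a (Zariski) closed
subgroup of `G(X)` that is isomorphic to `(Kˣ)^r` as an algebraic group. -/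
structure IsTorusOfDim (r : ℕ) (T : Subgroup (AffinePoint K A)ˣ) : Prop where
  /-- `T` is the intersection of `G(X)` with a closed subset of `X`. -/
  closed : ∃ C : Set (AffinePoint K A), IsClosed C ∧
    ∀ g : (AffinePoint K A)ˣ, g ∈ T ↔ (g : AffinePoint K A) ∈ C
  /-- There is an isomorphism of groups that is a morphism of varieties in both directions. -/
  iso : ∃ e : (Fin r → Kˣ) ≃* T,
    (∀ f : A, (fun t => ((e t : (AffinePoint K A)ˣ) : AffinePoint K A) f) ∈
      laurentFunctions K r) ∧
    ∀ i : Fin r, IsRegularOnSubgroup T (fun g => ((e.symm g i : Kˣ) : K))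

/-- `T` is a maximal torus of dimension `r` in `G(X)`. -/
def IsMaximalTorusOfDim (r : ℕ) (T : Subgroup (AffinePoint K A)ˣ) : Prop :=
  IsTorusOfDim r T ∧
    ∀ (s : ℕ) (S : Subgroup (AffinePoint K A)ˣ), IsTorusOfDim s S → T ≤ S → S = T

variable (K A) in
/-- The corank of the monoid is `c`: the group `G(X)` of invertible elements has a maximal torus
of codimension `c`. (All maximal tori are conjugate, so the choice of the torus is irrelevant.) -/
def HasCorank (c : ℕ) : Prop :=
  ∃ (r : ℕ) (T : Subgroup (AffinePoint K A)ˣ), IsMaximalTorusOfDim r T ∧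
    topologicalKrullDim {x : AffinePoint K A // IsUnit x} = ((r + c : ℕ) : WithBot ℕ∞)

end Corank

/-!
Let `T` be the given torus of dimension `r` in the group of units of `X`, so that `dim X = r + 1`
(the group of units is open: `MulIsMorphism.exists_isUnit_of_ne_zero`). The ideal `P` of functions
vanishing on `T` is a prime of height one, and normality of `X` makes the local ring at `P` a
discrete valuation ring. Its local parameter `f` can be chosen to be a weight vector for the action
of `T` on functions by conjugation, of weight `χ` say. Since `T` is commutative, conjugation acts
trivially on rational functions on `T`, whence a weight vector that vanishes to order `k` along
`P` has weight `χ ^ k` (`MulIsMorphism.IsWeightVector.eq_pow`).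

If `χ ≠ 1`, all weight vectors in `P` have nontrivial weight, so they vanish at central elements:
the center is contained in the closure `V(P)` of `T`. It does not contain `T`, and therefore has
dimension at most `r - 1`. On the other hand `ker χ` acts trivially by conjugation, hence is
central, and it contains a torus of dimension `r - 1`. So the center has dimension
`r - 1 = dim X - 2` (`MulIsMorphism.topologicalKrullDim_center`).

If `χ = 1`, then all weights are trivial and `T` is central. In that case `X` is commutative
(`MulIsMorphism.commute_of_central_codim_one`). The argument uses a vector field `L` transversal to
`V(P)`, which lowers the order of vanishing along `P` by one. Therefore no nonzero operator
with values in `P` commutes with `L` (`eq_zero_of_commute_derivation`). Applied to the difference of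
the left and the right invariant vector fields with the same value at `1`, this shows that they
agree; applied to the difference of left and right translation by a point, it shows that the point
is central.
-/

/-! ### Points and dimension of affine varieties -/

section AffineVarieties

variable {K B : Type*} [Field K] [CommRing B] [Algebra K B]

/-- Weak Nullstellensatz: a nonempty affine variety has a point. -/
theorem AffinePoint.nonempty [IsAlgClosed K] [Algebra.FiniteType K B] [Nontrivial B] :
    Nonempty (AffinePoint K B) := by
  obtain ⟨M, hM⟩ := Ideal.exists_maximal B
  let := Ideal.Quotient.field M
  have : Module.Finite K (B ⧸ M) := finite_of_finite_type_of_isJacobsonRing K (B ⧸ M)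
  have hb : Function.Bijective (algebraMap K (B ⧸ M)) :=
    IsAlgClosed.algebraMap_bijective_of_isIntegral
  exact ⟨((AlgEquiv.ofBijective (Algebra.ofId K (B ⧸ M)) hb).symm.toAlgHom.comp
    (Ideal.Quotient.mkₐ K M))⟩

/-- A function that does not belong to a prime ideal is nonzero at some zero of that ideal. -/
theorem AffinePoint.exists_ne_zero_of_notMem [IsAlgClosed K] [Algebra.FiniteType K B]
    (Q : Ideal B) [Q.IsPrime] {g : B} (hg : g ∉ Q) :
    ∃ x : AffinePoint K B, (∀ f ∈ Q, x f = 0) ∧ x g ≠ 0 := by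
  set g' : B ⧸ Q := Ideal.Quotient.mk Q g with hg'
  have hg0 : g' ≠ 0 := by rwa [hg', Ne, Ideal.Quotient.eq_zero_iff_mem]
  let C := Localization.Away g'
  have : Algebra.FiniteType (B ⧸ Q) C := IsLocalization.finiteType_of_monoid_fg (.powers g') C
  have : Algebra.FiniteType K C := Algebra.FiniteType.trans (S := B ⧸ Q) inferInstance inferInstance
  have : Nontrivial C := Function.Injective.nontrivial (IsLocalization.injective C
    (powers_le_nonZeroDivisors_of_noZeroDivisors hg0))
  obtain ⟨y⟩ := AffinePoint.nonempty (K := K) (B := C)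
  refine ⟨(y.toAlgHom.comp (IsScalarTower.toAlgHom K (B ⧸ Q) C)).comp (Ideal.Quotient.mkₐ K Q),
    fun f hf => ?_, ?_⟩
  · change y (algebraMap (B ⧸ Q) C (Ideal.Quotient.mk Q f)) = 0
    rw [Ideal.Quotient.eq_zero_iff_mem.2 hf, map_zero]
    exact map_zero y.toAlgHom
  · change y.toAlgHom (algebraMap (B ⧸ Q) C g') ≠ 0
    exact ((IsLocalization.Away.algebraMap_isUnit (S := C) g').map y.toAlgHom).ne_zero

/-- Regular functions on an irreducible variety are determined by their values. -/
theorem AffinePoint.funext_iff [IsAlgClosed K] [Algebra.FiniteType K B] [IsDomain B] {f g : B} :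
    f = g ↔ ∀ x : AffinePoint K B, x f = x g := by
  refine ⟨fun h _ => h ▸ rfl, fun h => ?_⟩
  by_contra hne
  obtain ⟨x, -, hx⟩ := AffinePoint.exists_ne_zero_of_notMem (K := K) (⊥ : Ideal B) (g := f - g)
    (by rwa [Ideal.mem_bot, sub_eq_zero])
  exact hx ((map_sub x.toAlgHom f g).trans (sub_eq_zero.2 (h x)))

theorem AffinePoint.isInducing_toPrimeSpectrum :
    Topology.IsInducing (toPrimeSpectrum : AffinePoint K B → PrimeSpectrum B) := ⟨rfl⟩

theorem AffinePoint.exists_basic_of_isOpen {U : Set (AffinePoint K B)} (hU : IsOpen U)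
    {x : AffinePoint K B} (hx : x ∈ U) :
    ∃ g : B, x g ≠ 0 ∧ ∀ y : AffinePoint K B, y g ≠ 0 → y ∈ U := by
  obtain ⟨S, hS⟩ := (isClosed_iff_zeroLocus _).1 hU.isClosed_compl
  have hx' : ¬ x ∈ {x : AffinePoint K B | ∀ f ∈ S, x f = 0} := hS ▸ fun h => h hx
  simp only [Set.mem_ofPred_eq, not_forall] at hx'
  obtain ⟨g, hg, hxg⟩ := hx'
  refine ⟨g, hxg, fun y hy => ?_⟩
  by_contra hyU
  have : y ∈ {x : AffinePoint K B | ∀ f ∈ S, x f = 0} := hS ▸ hyU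
  exact hy (this g hg)

/-- The irreducible closed subset of the variety defined by a prime ideal. -/
def AffinePoint.irreducibleZeroLocus [IsAlgClosed K] [Algebra.FiniteType K B]
    (Q : PrimeSpectrum B) : TopologicalSpace.IrreducibleCloseds (AffinePoint K B) where
  carrier := {x | ∀ f ∈ Q.asIdeal, x f = 0}
  isIrreducible' := by
    refine ⟨?_, fun U V hU hV => ?_⟩
    · obtain ⟨x, hx, -⟩ := exists_ne_zero_of_notMem (K := K) Q.asIdeal (g := 1)
        ((Ideal.ne_top_iff_one _).1 Q.2.ne_top)
      exact ⟨x, hx⟩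
    · rintro ⟨x, hx, hxU⟩ ⟨y, hy, hyV⟩
      obtain ⟨g, hxg, hg⟩ := exists_basic_of_isOpen hU hxU
      obtain ⟨h, hyh, hh⟩ := exists_basic_of_isOpen hV hyV
      obtain ⟨z, hz, hzg⟩ := exists_ne_zero_of_notMem (K := K) Q.asIdeal (g := g * h)
        (Q.2.mul_notMem (fun hm => hxg (hx g hm)) (fun hm => hyh (hy h hm)))
      have hzg' : z g * z h ≠ 0 := by rwa [← map_mul z.toAlgHom g h]
      exact ⟨z, hz, hg z (left_ne_zero_of_mul hzg'), hh z (right_ne_zero_of_mul hzg')⟩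
  isClosed' := (isClosed_iff_zeroLocus _).2 ⟨Q.asIdeal, rfl⟩

/-- The dimension of the space of points of an affine variety is the Krull dimension of its
coordinate algebra. -/
theorem AffinePoint.topologicalKrullDim_eq [IsAlgClosed K] [Algebra.FiniteType K B] :
    topologicalKrullDim (AffinePoint K B) = ringKrullDim B := by
  refine le_antisymm ?_ ?_
  · rw [← PrimeSpectrum.topologicalKrullDim_eq_ringKrullDim]
    exact isInducing_toPrimeSpectrum.topologicalKrullDim_le
  · rw [ringKrullDim, ← Order.krullDim_orderDual]
    refine Order.krullDim_le_of_strictMono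
      (fun Q : (PrimeSpectrum B)ᵒᵈ => irreducibleZeroLocus (K := K) (OrderDual.ofDual Q)) ?_
    intro Q Q' hlt
    have hlt' : (OrderDual.ofDual Q').asIdeal < (OrderDual.ofDual Q).asIdeal := hlt
    refine lt_of_le_not_ge (fun x hx f hf => hx f (hlt'.le hf)) fun hge => ?_
    obtain ⟨f, hf, hf'⟩ := Set.exists_of_ssubset hlt'
    obtain ⟨x, hx, hxf⟩ := exists_ne_zero_of_notMem (K := K) _ hf'
    exact hxf (hge hx f hf)

/-- A surjection of coordinate algebras induces a topological embedding of points. -/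
theorem AffinePoint.isInducing_comp_of_surjective {C : Type*} [CommRing C] [Algebra K C]
    (φ : B →ₐ[K] C) (hφ : Function.Surjective φ) :
    Topology.IsInducing (Y := AffinePoint K B)
      (fun x : AffinePoint K C => x.toAlgHom.comp φ) := by
  have h := (PrimeSpectrum.isClosedEmbedding_comap_of_surjective C φ.toRingHom hφ).isInducing
  refine (isInducing_toPrimeSpectrum (K := K) (B := B)).of_comp_iff.1 ?_
  exact h.comp (isInducing_toPrimeSpectrum (K := K) (B := C))

theorem AffinePoint.isInducing_comp_of_isLocalization {C : Type*} [CommRing C] [Algebra K C]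
    [Algebra B C] [IsScalarTower K B C] (M : Submonoid B) [IsLocalization M C] :
    Topology.IsInducing (Y := AffinePoint K B)
      (fun x : AffinePoint K C => x.toAlgHom.comp (IsScalarTower.toAlgHom K B C)) := by
  have h := (PrimeSpectrum.localization_comap_isEmbedding C M).isInducing
  refine (isInducing_toPrimeSpectrum (K := K) (B := B)).of_comp_iff.1 ?_
  exact h.comp (isInducing_toPrimeSpectrum (K := K) (B := C))

theorem ringKrullDim_eq_of_isIntegral_of_injective {R S : Type*} [CommRing R] [CommRing S]
    [IsDomain S] [Algebra R S] [Algebra.IsIntegral R S] (hinj : Function.Injective (algebraMap R S)) :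
    ringKrullDim S = ringKrullDim R := by
  refine le_antisymm ?_ ?_
  · refine Order.krullDim_le_of_strictMono (PrimeSpectrum.comap (algebraMap R S)) ?_
    intro P Q hlt
    exact Ideal.IsIntegral.comap_lt_comap hlt
  · refine iSup_le fun l => ?_
    obtain ⟨P, hP, hPl⟩ := Ideal.exists_ideal_over_prime_of_isIntegral_of_isDomain
      (S := S) l.head.asIdeal (by simp [(RingHom.injective_iff_ker_eq_bot _).1 hinj])
    have : P.LiesOver l.head.asIdeal := ⟨hPl.symm⟩
    obtain ⟨l', hl', -⟩ := Ideal.exists_ltSeries_of_hasGoingUp l P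
    exact hl' ▸ Order.LTSeries.length_le_krullDim l'

/-- The Krull dimension of a finitely generated domain is its transcendence degree. -/
theorem exists_ringKrullDim_eq_trdeg [IsDomain B] [Algebra.FiniteType K B] :
    ∃ n : ℕ, ringKrullDim B = n ∧ Algebra.trdeg K B = n := by
  obtain ⟨s, g, hinj, hint⟩ := exists_integral_inj_algHom_of_fg K B
  algebraize [g.toRingHom]
  have : Algebra.IsIntegral (MvPolynomial (Fin s) K) B := ⟨hint⟩
  have : IsScalarTower K (MvPolynomial (Fin s) K) B := .of_algebraMap_eq fun x => (g.commutes x).symm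
  have : FaithfulSMul (MvPolynomial (Fin s) K) B :=
    (faithfulSMul_iff_algebraMap_injective _ _).2 hinj
  refine ⟨s, ?_, ?_⟩
  · rw [ringKrullDim_eq_of_isIntegral_of_injective (R := MvPolynomial (Fin s) K) hinj,
      MvPolynomial.ringKrullDim_of_isNoetherianRing]
    simp
  · have h := lift_trdeg_add_eq K (MvPolynomial (Fin s) K) B
    rw [trdeg_eq_zero (R := MvPolynomial (Fin s) K) (A := B)] at h
    simpa using h.symm

end AffineVarieties

/-! ### Order of vanishing along a prime divisor -/

section PrimeDivisor

variable {A : Type*} [CommRing A]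

/-- `HasOrder P f a k` says that `a` vanishes to order exactly `k` along the prime `P`, where `f` is
a function that vanishes to order one: up to factors outside `P`, `a` equals `f ^ k`. -/
def HasOrder (P : Ideal A) (f a : A) (k : ℕ) : Prop :=
  ∃ s u : A, s ∉ P ∧ u ∉ P ∧ s * a = u * f ^ k

/-- `f` generates the maximal ideal of the local ring at `P`. -/
def IsUniformizerAt (P : Ideal A) [P.IsPrime] (f : A) : Prop :=
  Irreducible (algebraMap A (Localization.AtPrime P) f)

theorem isUnit_algebraMap_localization_iff (P : Ideal A) [P.IsPrime] {a : A} :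
    IsUnit (algebraMap A (Localization.AtPrime P) a) ↔ a ∉ P :=
  IsLocalization.AtPrime.isUnit_to_map_iff _ P a

theorem IsUniformizerAt.mem {P : Ideal A} [P.IsPrime] {f : A} (hf : IsUniformizerAt P f) :
    f ∈ P := by
  by_contra h
  exact hf.not_isUnit ((isUnit_algebraMap_localization_iff P).2 h)

theorem HasOrder.pos_of_mem {P : Ideal A} [P.IsPrime] {f a : A} {k : ℕ}
    (h : HasOrder P f a k) (ha : a ∈ P) : 0 < k := by
  obtain ⟨s, u, hs, hu, h⟩ := h
  rw [Nat.pos_iff_ne_zero]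
  rintro rfl
  rw [pow_zero, mul_one] at h
  exact hu (h ▸ P.mul_mem_left s ha)

/-- A derivation that does not preserve `P` lowers every positive order of vanishing by one. -/
theorem HasOrder.derivation {K : Type*} [Field K] [CharZero K] [Algebra K A]
    {P : Ideal A} [P.IsPrime] {f a : A} (hf : f ∈ P) (L : Derivation K A A)
    (hL : L f ∉ P) {k : ℕ} (h : HasOrder P f a (k + 1)) : HasOrder P f (L a) k := by
  obtain ⟨s, u, hs, hu, h⟩ := h
  have h1 := congrArg L h
  simp only [Derivation.leibniz, Derivation.leibniz_pow, smul_eq_mul, nsmul_eq_mul,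
    Nat.add_sub_cancel] at h1
  have hk : ((k + 1 : ℕ) : A) ∉ P := fun hmem => by
    refine Ideal.IsPrime.ne_top (I := P) inferInstance (Ideal.eq_top_of_isUnit_mem _ hmem ?_)
    have := (isUnit_iff_ne_zero.2 (Nat.cast_ne_zero (R := K).2 k.succ_ne_zero)).map (algebraMap K A)
    rwa [map_natCast] at this
  refine ⟨s * s, u * s * ((k + 1 : ℕ) : A) * L f + f * (s * L u - u * L s),
    Ideal.IsPrime.mul_notMem inferInstance hs hs, fun hmem => ?_, ?_⟩
  · have h2 := (Ideal.add_mem_iff_left P (P.mul_mem_right (s * L u - u * L s) hf)).1 hmem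
    exact Ideal.IsPrime.mul_notMem inferInstance (Ideal.IsPrime.mul_notMem inferInstance
      (Ideal.IsPrime.mul_notMem inferInstance hu hs) hk) hL h2
  · linear_combination s * h1 - L s * h

/-- A function that vanishes to order one may be used as the reference function. -/
theorem IsUniformizerAt.of_hasOrder_one {P : Ideal A} [P.IsPrime] {f a : A}
    (hf : IsUniformizerAt P f) (h : HasOrder P f a 1) : IsUniformizerAt P a := by
  obtain ⟨s, u, hs, hu, h⟩ := h
  rw [pow_one] at h
  have h' := congrArg (algebraMap A (Localization.AtPrime P)) h
  rw [map_mul, map_mul] at h'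
  rw [IsUniformizerAt, ← irreducible_isUnit_mul ((isUnit_algebraMap_localization_iff P).2 hs), h',
    irreducible_isUnit_mul ((isUnit_algebraMap_localization_iff P).2 hu)]
  exact hf

variable [IsDomain A]

theorem isDiscreteValuationRing_localization_of_height_one [IsNoetherianRing A]
    [IsIntegrallyClosed A] (P : Ideal A) [P.IsPrime] (hP : P ≠ ⊥)
    (hmin : ∀ Q : Ideal A, Q.IsPrime → Q ≤ P → Q ≠ ⊥ → Q = P) :
    IsDiscreteValuationRing (Localization.AtPrime P) := by
  have hle : P.primeCompl ≤ nonZeroDivisors A := P.primeCompl_le_nonZeroDivisors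
  have hinj : Function.Injective (algebraMap A (Localization.AtPrime P)) :=
    IsLocalization.injective _ hle
  have : IsNoetherianRing (Localization.AtPrime P) :=
    IsLocalization.isNoetherianRing P.primeCompl _ inferInstance
  have hic : IsIntegrallyClosed (Localization.AtPrime P) :=
    isIntegrallyClosed_of_isLocalization _ P.primeCompl hle
  have hcomap : (IsLocalRing.maximalIdeal (Localization.AtPrime P)).comap
      (algebraMap A (Localization.AtPrime P)) = P := Localization.AtPrime.under_maximalIdeal
  have hmax : IsLocalRing.maximalIdeal (Localization.AtPrime P) ≠ ⊥ := by
    intro h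
    rw [h, ← RingHom.ker_eq_comap_bot, (RingHom.injective_iff_ker_eq_bot _).1 hinj] at hcomap
    exact hP hcomap.symm
  have hf : ¬ IsField (Localization.AtPrime P) := fun h =>
    hmax (IsLocalRing.isField_iff_maximalIdeal_eq.1 h)
  have htfae := (IsDiscreteValuationRing.TFAE (Localization.AtPrime P) hf).out 0 3
  refine htfae.2 ⟨hic, _, ⟨hmax, inferInstance⟩, fun Q ⟨hQ, hQp⟩ => ?_⟩
  have hc : Q.under A = P := by
    refine hmin _ inferInstance ?_ ?_
    · exact (Ideal.comap_mono (IsLocalRing.le_maximalIdeal hQp.ne_top)).trans hcomap.le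
    · intro h
      apply hQ
      rw [← IsLocalization.map_under P.primeCompl _ Q, h, Ideal.map_bot]
  rw [← IsLocalization.map_under P.primeCompl _ Q, hc, Localization.AtPrime.map_eq_maximalIdeal]

theorem exists_isUniformizerAt (P : Ideal A) [P.IsPrime]
    [IsDiscreteValuationRing (Localization.AtPrime P)] : ∃ f : A, IsUniformizerAt P f := by
  obtain ⟨ϖ, hϖ⟩ := IsDiscreteValuationRing.exists_irreducible (Localization.AtPrime P)
  obtain ⟨⟨f, s⟩, hfs⟩ := IsLocalization.surj P.primeCompl ϖ
  refine ⟨f, ?_⟩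
  rw [IsUniformizerAt, ← hfs]
  exact (irreducible_mul_isUnit (IsLocalization.map_units _ s)).2 hϖ

theorem IsUniformizerAt.exists_hasOrder {P : Ideal A} [P.IsPrime]
    [IsDiscreteValuationRing (Localization.AtPrime P)] {f : A} (hf : IsUniformizerAt P f)
    {a : A} (ha : a ≠ 0) : ∃ k, HasOrder P f a k := by
  have hinj : Function.Injective (algebraMap A (Localization.AtPrime P)) :=
    IsLocalization.injective _ P.primeCompl_le_nonZeroDivisors
  obtain ⟨k, v, hv⟩ := IsDiscreteValuationRing.associated_pow_irreducible
    ((map_ne_zero_iff _ hinj).2 ha) hf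
  obtain ⟨⟨s, u⟩, hsu⟩ := IsLocalization.surj P.primeCompl (v : Localization.AtPrime P)
  refine ⟨k, s, u, ?_, u.2, hinj ?_⟩
  · rw [← isUnit_algebraMap_localization_iff P, ← hsu]
    exact v.isUnit.mul (IsLocalization.map_units _ u)
  · simp only [map_mul, map_pow, ← hv]
    rw [← hsu]
    ring

/-- If a derivation `L` moves some element of `P` out of `P`, it does so with every function that
vanishes to order one along `P`. -/
theorem IsUniformizerAt.derivation_notMem {K : Type*} [Field K] [Algebra K A]
    {P : Ideal A} [P.IsPrime] [IsDiscreteValuationRing (Localization.AtPrime P)] {f g : A}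
    (hf : IsUniformizerAt P f) (L : Derivation K A A) (hg : g ∈ P) (hL : L g ∉ P) : L f ∉ P := by
  intro hLf
  have hg0 : g ≠ 0 := by
    rintro rfl
    exact hL (by simp)
  obtain ⟨k, hk⟩ := hf.exists_hasOrder hg0
  have hpos := hk.pos_of_mem hg
  obtain ⟨s, u, hs, hu, h⟩ := hk
  have h1 := congrArg L h
  simp only [Derivation.leibniz, Derivation.leibniz_pow, smul_eq_mul, nsmul_eq_mul] at h1
  have h2 : s * L g ∈ P := by
    have : s * L g = u * (k * (f ^ (k - 1) * L f)) + f ^ k * L u - g * L s := by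
      linear_combination h1
    rw [this]
    refine P.sub_mem (P.add_mem (P.mul_mem_left _ (P.mul_mem_left _ (P.mul_mem_left _ hLf)))
      (P.mul_mem_right _ (P.pow_mem_of_mem hf.mem _ hpos))) (P.mul_mem_right _ hg)
  exact (Ideal.IsPrime.mul_notMem inferInstance hs hL) h2

/-- The rigidity principle behind the commutativity results: a map with values in `P`
that commutes with a derivation `L` not preserving `P` vanishes. Indeed `L` lowers the minimal order
of vanishing of its values, and yet maps values to values. -/
theorem eq_zero_of_commute_derivation {K : Type*} [Field K] [CharZero K] [Algebra K A]
    {P : Ideal A} [P.IsPrime] [IsDiscreteValuationRing (Localization.AtPrime P)]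
    (L : Derivation K A A) {g : A} (hg : g ∈ P) (hL : L g ∉ P) (E : A → A)
    (hE : ∀ a, E a ∈ P) (hcomm : ∀ a, L (E a) = E (L a)) (a : A) : E a = 0 := by
  obtain ⟨f, hf⟩ := exists_isUniformizerAt P
  have hLf := hf.derivation_notMem L hg hL
  have key : ∀ k a, ¬ HasOrder P f (E a) k := by
    intro k
    induction k with
    | zero => exact fun a h => lt_irrefl _ (h.pos_of_mem (hE a))
    | succ k ih => exact fun a h => ih (L a) (hcomm a ▸ h.derivation hf.mem L hLf)
  by_contra h
  obtain ⟨k, hk⟩ := hf.exists_hasOrder h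
  exact key k a hk

end PrimeDivisor

/-! ### Derivations transversal to a prime divisor -/

section Transversal

variable {K A : Type*} [Field K] [CharZero K] [CommRing A] [IsDomain A] [Algebra K A]
  [Algebra.FiniteType K A]

/-- A function `f` vanishing to order one along `P` has nonzero derivative in some direction: there
is a derivation with values in the residue field of `P` that does not kill `f`. In characteristic
zero the residue field `κ` is formally smooth, so that `A_P / P²` is the `κ`-vector space spanned by
`1` and `f`, and the coefficient of `f` is the required derivation. -/
theorem IsUniformizerAt.exists_derivation_residueField {P : Ideal A} [P.IsPrime]
    [IsDiscreteValuationRing (Localization.AtPrime P)] {f : A} (hf : IsUniformizerAt P f) :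
    ∃ θ : Derivation K A P.ResidueField, θ f ≠ 0 := by
  have : Algebra.EssFiniteType (A ⧸ P) P.ResidueField :=
    .of_isLocalization _ (nonZeroDivisors (A ⧸ P))
  have : Algebra.EssFiniteType K P.ResidueField := .comp K (A ⧸ P) _
  have : Algebra.FormallySmooth K P.ResidueField := inferInstance
  let R := Localization.AtPrime P
  let m := IsLocalRing.maximalIdeal R
  let ϖ : R := algebraMap A R f
  have hm : m = Ideal.span {ϖ} := hf.maximalIdeal_eq
  let q : R →ₐ[K] R ⧸ m ^ 2 := Ideal.Quotient.mkₐ K (m ^ 2)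
  let ρ : R →ₐ[K] P.ResidueField := IsScalarTower.toAlgHom K R P.ResidueField
  have hρ : Function.Surjective ρ := Ideal.Quotient.mk_surjective
  have hρ0 : ∀ x, ρ x = 0 ↔ x ∈ m := fun x => Ideal.Quotient.eq_zero_iff_mem
  have hker : ∀ x ∈ m ^ 2, ρ x = 0 := fun x hx => (hρ0 x).2 (Ideal.pow_le_self two_ne_zero hx)
  let π : R ⧸ m ^ 2 →ₐ[K] P.ResidueField := Ideal.Quotient.liftₐ (m ^ 2) ρ hker
  have hπq : ∀ x, π (q x) = ρ x := fun x => Ideal.Quotient.liftₐ_apply _ _ _ _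
  have hπ : Function.Surjective π := fun y => (hρ y).imp' q fun x hx => (hπq x).trans hx
  have hq : Function.Surjective q := Ideal.Quotient.mk_surjective
  have hq0 : ∀ x, q x = 0 ↔ x ∈ m ^ 2 := fun x => Ideal.Quotient.eq_zero_iff_mem
  have hnil : IsNilpotent (RingHom.ker (π : R ⧸ m ^ 2 →+* P.ResidueField)) := by
    suffices h : RingHom.ker (π : R ⧸ m ^ 2 →+* P.ResidueField) *
        RingHom.ker (π : R ⧸ m ^ 2 →+* P.ResidueField) ≤ ⊥ from
      ⟨2, (Submodule.pow_succ _).trans (by rw [Submodule.pow_one]; exact le_bot_iff.1 h)⟩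
    refine Ideal.mul_le.2 fun x hx y hy => ?_
    obtain ⟨x, rfl⟩ := hq x
    obtain ⟨y, rfl⟩ := hq y
    have hx' : x ∈ m := (hρ0 x).1 ((hπq x).symm.trans hx)
    have hy' : y ∈ m := (hρ0 y).1 ((hπq y).symm.trans hy)
    rw [Ideal.mem_bot, ← map_mul, hq0, pow_two]
    exact Ideal.mul_mem_mul hx' hy'
  let σ : P.ResidueField →ₐ[K] R ⧸ m ^ 2 :=
    Algebra.FormallySmooth.liftOfSurjective (AlgHom.id K _) π hπ hnil
  have hσ : ∀ c, π (σ c) = c := fun c =>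
    Algebra.FormallySmooth.liftOfSurjective_apply (AlgHom.id K _) π hπ hnil c
  have hex0 : ∀ z, π z = 0 → ∃ y : R, z = q y * q ϖ := by
    intro z hz
    obtain ⟨x, rfl⟩ := hq z
    have hx : x ∈ m := (hρ0 x).1 ((hπq x).symm.trans hz)
    rw [hm, Ideal.mem_span_singleton'] at hx
    obtain ⟨y, rfl⟩ := hx
    exact ⟨y, map_mul q _ _⟩
  have hϖ2 : q ϖ * q ϖ = 0 := by
    rw [← map_mul, hq0, pow_two]
    have hϖm : ϖ ∈ m := hm.symm ▸ Ideal.mem_span_singleton_self ϖ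
    exact Ideal.mul_mem_mul hϖm hϖm
  have hex : ∀ z, π z = 0 → ∃ c, z = σ c * q ϖ := by
    intro z hz
    obtain ⟨y, rfl⟩ := hex0 z hz
    obtain ⟨w, hw⟩ := hex0 (q y - σ (ρ y)) (by rw [map_sub, hσ, hπq, sub_self])
    refine ⟨ρ y, ?_⟩
    linear_combination q ϖ * hw + q w * hϖ2
  have hϖ0 : q ϖ ≠ 0 := by
    rw [Ne, hq0, hm, Ideal.span_singleton_pow, Ideal.mem_span_singleton']
    rintro ⟨y, hy⟩
    have : ϖ * (y * ϖ) = ϖ * 1 := by linear_combination hy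
    exact hf.not_isUnit (IsUnit.of_mul_eq_one_right _ (mul_left_cancel₀ hf.ne_zero this))
  have huniq : ∀ c c', σ c * q ϖ = σ c' * q ϖ → c = c' := by
    intro c c' h
    by_contra hne
    have h1 : σ (c - c') * q ϖ = 0 := by rw [map_sub, sub_mul, h, sub_self]
    have h2 : σ (c - c')⁻¹ * σ (c - c') = 1 := by
      rw [← map_mul, inv_mul_cancel₀ (sub_ne_zero.2 hne), map_one]
    exact hϖ0 (by linear_combination σ (c - c')⁻¹ * h1 - q ϖ * h2)
  -- `θ a` is the coefficient of `f` in the expansion of `a` modulo `P²`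
  have hθ : ∀ a : A, ∃ c, q (algebraMap A R a) - σ (ρ (algebraMap A R a)) = σ c * q ϖ := fun a =>
    hex _ (by rw [map_sub, hσ, hπq, sub_self])
  choose θ hθ using hθ
  have hsmul : ∀ (a : A) (c : P.ResidueField), a • c = ρ (algebraMap A R a) * c := fun a c => by
    rw [Algebra.smul_def, IsScalarTower.algebraMap_apply A R P.ResidueField]
    rfl
  let θ' : A →ₗ[K] P.ResidueField :=
    { toFun := θ
      map_add' := fun a b => huniq _ _ (by
        rw [← hθ, map_add, map_add, map_add, map_add, map_add]
        linear_combination hθ a + hθ b)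
      map_smul' := fun r a => huniq _ _ (by
        rw [← hθ, RingHom.id_apply, Algebra.smul_def, Algebra.smul_def, map_mul, map_mul, map_mul,
          map_mul, map_mul, ← IsScalarTower.algebraMap_apply, AlgHom.commutes, AlgHom.commutes,
          AlgHom.commutes]
        linear_combination (algebraMap K (R ⧸ m ^ 2) r) * hθ a) }
  refine ⟨Derivation.mk' θ' fun a b => huniq _ _ ?_, ?_⟩
  · change σ (θ (a * b)) * q ϖ = σ (a • θ b + b • θ a) * q ϖ
    rw [← hθ, hsmul, hsmul]
    simp only [map_mul, map_add]
    linear_combination q (algebraMap A R a) * hθ b + σ (ρ (algebraMap A R b)) * hθ a +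
      σ (θ b) * q ϖ * hθ a + σ (θ a) * σ (θ b) * hϖ2
  · intro h0
    have h1 := hθ f
    have h2 : ρ (algebraMap A R f) = 0 := (hρ0 _).2 (hm.symm ▸ Ideal.mem_span_singleton_self ϖ)
    have h3 : θ f = 0 := h0
    rw [h2, h3, map_zero, sub_zero, zero_mul] at h1
    exact hϖ0 h1

/-- If `P` is the ideal of functions vanishing on a set `S` of points, then a function vanishing to
order one along `P` has a nonzero derivative along some tangent vector at some point of `S`. -/
theorem IsUniformizerAt.exists_pointDerivation {P : Ideal A} [P.IsPrime]
    [IsDiscreteValuationRing (Localization.AtPrime P)] {f : A} (hf : IsUniformizerAt P f)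
    (S : Set (AffinePoint K A)) (hS : ∀ g, g ∈ P ↔ ∀ t ∈ S, t g = 0) :
    ∃ t ∈ S, ∃ δ : A →ₗ[K] K, (∀ a b, δ (a * b) = t a * δ b + t b * δ a) ∧ δ f ≠ 0 := by
  obtain ⟨θ, hθ⟩ := hf.exists_derivation_residueField (K := K)
  obtain ⟨s, hs⟩ := (inferInstance : Algebra.FiniteType K A).out
  classical
  obtain ⟨⟨b', hb'⟩, hb⟩ := IsLocalization.exist_integer_multiples_of_finset
    (nonZeroDivisors (A ⧸ P)) (s.image θ)
  obtain ⟨b, rfl⟩ := Ideal.Quotient.mk_surjective b'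
  have hbP : b ∉ P := by
    rw [← Ideal.Quotient.eq_zero_iff_mem]
    exact nonZeroDivisors.ne_zero hb'
  have hb0 : algebraMap A P.ResidueField b ≠ 0 := by
    rwa [Ne, ← RingHom.mem_ker, Ideal.ker_algebraMap_residueField]
  have hgen : ∀ a : A, ∃ c : A, algebraMap A P.ResidueField c = b • θ a := by
    intro a
    have ha : a ∈ Algebra.adjoin K (s : Set A) := hs ▸ Algebra.mem_top
    induction ha using Algebra.adjoin_induction with
    | mem x hx =>
      obtain ⟨c, hc⟩ := hb (θ x) (Finset.mem_image_of_mem θ hx)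
      obtain ⟨c, rfl⟩ := Ideal.Quotient.mk_surjective c
      refine ⟨c, hc.trans ?_⟩
      rw [Algebra.smul_def, Algebra.smul_def]
      rfl
    | algebraMap r => exact ⟨0, by simp⟩
    | add x y _ _ hx hy =>
      obtain ⟨c, hc⟩ := hx
      obtain ⟨d, hd⟩ := hy
      exact ⟨c + d, by rw [map_add, hc, hd, map_add, smul_add]⟩
    | mul x y _ _ hx hy =>
      obtain ⟨c, hc⟩ := hx
      obtain ⟨d, hd⟩ := hy
      refine ⟨x * d + y * c, ?_⟩
      rw [map_add, map_mul, map_mul, hc, hd, Derivation.leibniz]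
      simp only [Algebra.smul_def]
      ring
  choose c hc using hgen
  have hcong : ∀ {x y : A}, algebraMap A P.ResidueField x = algebraMap A P.ResidueField y →
      ∀ t ∈ S, t x = t y := by
    intro x y hxy t ht
    rw [← sub_eq_zero, ← map_sub, ← RingHom.mem_ker, Ideal.ker_algebraMap_residueField] at hxy
    exact sub_eq_zero.1 ((map_sub t.toAlgHom x y).symm.trans ((hS _).1 hxy t ht))
  have hcf : c f ∉ P := by
    rw [← Ideal.ker_algebraMap_residueField P, RingHom.mem_ker, hc, Algebra.smul_def]
    exact mul_ne_zero hb0 hθ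
  obtain ⟨t, ht, htf⟩ : ∃ t ∈ S, t (c f) ≠ 0 := by
    by_contra! h
    exact hcf ((hS _).2 h)
  refine ⟨t, ht, ⟨⟨fun a => t (c a), fun x y => ?_⟩, fun r x => ?_⟩, fun x y => ?_, htf⟩
  · refine (hcong (y := c x + c y) ?_ t ht).trans (map_add t.toAlgHom _ _)
    rw [map_add, hc, hc, hc, map_add, smul_add]
  · refine (hcong (y := r • c x) ?_ t ht).trans (map_smul t.toAlgHom r _)
    rw [hc, Algebra.smul_def r (c x), map_mul, hc, Derivation.map_smul, smul_comm,
      ← IsScalarTower.algebraMap_apply, ← Algebra.smul_def]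
  · refine (hcong (y := x * c y + y * c x) ?_ t ht).trans ?_
    · rw [map_add, map_mul, map_mul, hc, hc, hc, Derivation.leibniz]
      simp only [Algebra.smul_def]
      ring
    · exact (map_add t.toAlgHom _ _).trans
        (congrArg₂ _ (map_mul t.toAlgHom _ _) (map_mul t.toAlgHom _ _))

end Transversal

/-! ### Functions and characters of the standard torus -/

section Torus

variable {K : Type*} [Field K]

/-- The `i`-th coordinate function of the standard torus. -/
def torusCoord (K : Type*) [Field K] {r : ℕ} (i : Fin r) : laurentFunctions K r :=
  ⟨fun t => ((t i : Kˣ) : K), Algebra.subset_adjoin (Or.inl ⟨i, rfl⟩)⟩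

theorem inv_coord_mem_laurentFunctions {r : ℕ} (i : Fin r) :
    (fun t : Fin r → Kˣ => (((t i)⁻¹ : Kˣ) : K)) ∈ laurentFunctions K r :=
  Algebra.subset_adjoin (Or.inr ⟨i, rfl⟩)

/-- Pulling back along a homomorphism of tori whose coordinates, together with their inverses, are
Laurent functions maps Laurent functions to Laurent functions. -/
theorem comp_mem_laurentFunctions {r m : ℕ} (ψ : (Fin m → Kˣ) → (Fin r → Kˣ))
    (h : ∀ i, (fun s => ((ψ s i : Kˣ) : K)) ∈ laurentFunctions K m)
    (h' : ∀ i, (fun s => (((ψ s i)⁻¹ : Kˣ) : K)) ∈ laurentFunctions K m)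
    {φ : (Fin r → Kˣ) → K} (hφ : φ ∈ laurentFunctions K r) :
    (fun s => φ (ψ s)) ∈ laurentFunctions K m := by
  induction hφ using Algebra.adjoin_induction with
  | mem x hx =>
    rcases hx with ⟨i, rfl⟩ | ⟨i, rfl⟩
    exacts [h i, h' i]
  | algebraMap c => exact (laurentFunctions K m).algebraMap_mem c
  | add x y _ _ hx hy => exact (laurentFunctions K m).add_mem hx hy
  | mul x y _ _ hx hy => exact (laurentFunctions K m).mul_mem hx hy

theorem comp_inv_mem_laurentFunctions {r : ℕ} {φ : (Fin r → Kˣ) → K}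
    (hφ : φ ∈ laurentFunctions K r) : (fun t => φ t⁻¹) ∈ laurentFunctions K r :=
  comp_mem_laurentFunctions (fun t => t⁻¹) (fun i => inv_coord_mem_laurentFunctions i)
    (fun i => by
      simp only [Pi.inv_apply, inv_inv]
      exact (torusCoord K i).2) hφ

/-- The character of the standard torus given by a Laurent monomial. -/
def torusCharacter (K : Type*) [Field K] {r : ℕ} (n : Fin r → ℤ) : (Fin r → Kˣ) →* K where
  toFun t := ((∏ i, t i ^ n i : Kˣ) : K)
  map_one' := by simp
  map_mul' s t := by simp [mul_zpow, Finset.prod_mul_distrib]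

theorem torusCharacter_zero {r : ℕ} : torusCharacter K (0 : Fin r → ℤ) = 1 := by
  ext t
  simp [torusCharacter]

theorem torusCharacter_add {r : ℕ} (n n' : Fin r → ℤ) :
    torusCharacter K (n + n') = torusCharacter K n * torusCharacter K n' := by
  ext t
  simp [torusCharacter, zpow_add, Finset.prod_mul_distrib]

theorem laurentFunctions_le_span_torusCharacter {r : ℕ} {φ : (Fin r → Kˣ) → K}
    (hφ : φ ∈ laurentFunctions K r) :
    φ ∈ Submodule.span K
      (Set.range fun n : Fin r → ℤ => (torusCharacter K n : (Fin r → Kˣ) → K)) := by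
  have hpow : ∀ (i : Fin r) (e : ℤ) (t : Fin r → Kˣ),
      torusCharacter K (Pi.single i e) t = ((t i ^ e : Kˣ) : K) := by
    intro i e t
    change ((∏ j, t j ^ (Pi.single i e : Fin r → ℤ) j : Kˣ) : K) = _
    rw [Finset.prod_eq_single i (fun j _ hj => by simp [hj]) (by simp), Pi.single_eq_same]
  induction hφ using Algebra.adjoin_induction with
  | mem x hx =>
    rcases hx with ⟨i, rfl⟩ | ⟨i, rfl⟩
    · exact Submodule.subset_span ⟨Pi.single i 1, funext fun t => by simp [hpow]⟩
    · exact Submodule.subset_span ⟨Pi.single i (-1), funext fun t => by simp [hpow]⟩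
  | algebraMap c =>
    have : algebraMap K ((Fin r → Kˣ) → K) c = c • (torusCharacter K 0 : (Fin r → Kˣ) → K) := by
      rw [torusCharacter_zero]
      ext t
      simp
    rw [this]
    exact Submodule.smul_mem _ _ (Submodule.subset_span ⟨0, rfl⟩)
  | add x y _ _ hx hy => exact Submodule.add_mem _ hx hy
  | mul x y _ _ hx hy =>
    have := Submodule.mul_mem_mul hx hy
    rw [Submodule.span_mul_span] at this
    refine Submodule.span_mono ?_ this
    rintro _ ⟨_, ⟨n, rfl⟩, _, ⟨n', rfl⟩, rfl⟩
    exact ⟨n + n', by simp only [torusCharacter_add]; rfl⟩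

/-- A Laurent function is a polynomial function divided by a monomial. -/
theorem exists_polynomial_of_mem_laurentFunctions {r : ℕ} {φ : (Fin r → Kˣ) → K}
    (hφ : φ ∈ laurentFunctions K r) : ∃ (N : ℕ) (p : MvPolynomial (Fin r) K), ∀ t,
      (∏ i, (t i : K)) ^ N * φ t = MvPolynomial.eval (fun i => (t i : K)) p := by
  induction hφ using Algebra.adjoin_induction with
  | mem x hx =>
    rcases hx with ⟨i, rfl⟩ | ⟨i, rfl⟩
    · exact ⟨0, .X i, fun t => by simp⟩
    · refine ⟨1, ∏ j ∈ Finset.univ.erase i, .X j, fun t => ?_⟩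
      rw [pow_one, map_prod, ← Finset.mul_prod_erase _ _ (Finset.mem_univ i)]
      simp only [MvPolynomial.eval_X]
      rw [mul_right_comm, Units.mul_inv, one_mul]
  | algebraMap c => exact ⟨0, .C c, fun t => by simp⟩
  | add x y _ _ hx hy =>
    obtain ⟨N, p, hp⟩ := hx
    obtain ⟨M, q, hq⟩ := hy
    refine ⟨N + M, (∏ i, .X i) ^ M * p + (∏ i, .X i) ^ N * q, fun t => ?_⟩
    simp only [map_add, map_mul, map_pow, map_prod, MvPolynomial.eval_X, ← hp, ← hq,
      Pi.add_apply]
    ring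
  | mul x y _ _ hx hy =>
    obtain ⟨N, p, hp⟩ := hx
    obtain ⟨M, q, hq⟩ := hy
    refine ⟨N + M, p * q, fun t => ?_⟩
    simp only [map_mul, ← hp, ← hq, Pi.mul_apply]
    ring

theorem MvPolynomial.eq_zero_of_eval_torus_eq_zero [Infinite K] {r : ℕ}
    {p : MvPolynomial (Fin r) K}
    (h : ∀ t : Fin r → Kˣ, MvPolynomial.eval (fun i => (t i : K)) p = 0) : p = 0 := by
  refine MvPolynomial.funext_set (fun _ : Fin r => ({0}ᶜ : Set K))
    (fun _ => (Set.finite_singleton (0 : K)).infinite_compl) fun x hx => ?_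
  rw [map_zero]
  exact h fun i => Units.mk0 (x i) (hx i (Set.mem_univ i))

instance laurentFunctions.isDomain [Infinite K] (r : ℕ) : IsDomain (laurentFunctions K r) := by
  have hprod : ∀ (t : Fin r → Kˣ) (N : ℕ), (∏ i, (t i : K)) ^ N ≠ 0 := fun t N =>
    pow_ne_zero _ (Finset.prod_ne_zero_iff.2 fun i _ => (t i).ne_zero)
  have : NoZeroDivisors (laurentFunctions K r) := by
    refine ⟨fun {φ ψ} h => ?_⟩
    obtain ⟨N, p, hp⟩ := exists_polynomial_of_mem_laurentFunctions φ.2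
    obtain ⟨M, q, hq⟩ := exists_polynomial_of_mem_laurentFunctions ψ.2
    have hφψ : ∀ t, φ.1 t * ψ.1 t = 0 := fun t => congrFun (congrArg Subtype.val h) t
    have hpq : p * q = 0 := MvPolynomial.eq_zero_of_eval_torus_eq_zero fun t => by
      rw [map_mul, ← hp, ← hq]
      linear_combination (∏ i, (t i : K)) ^ N * (∏ i, (t i : K)) ^ M * hφψ t
    refine (mul_eq_zero.1 hpq).imp (fun h0 => ?_) (fun h0 => ?_)
    · refine Subtype.ext (funext fun t => ?_)
      have := hp t
      rw [h0, map_zero, mul_eq_zero, or_iff_right (hprod t N)] at this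
      exact this
    · refine Subtype.ext (funext fun t => ?_)
      have := hq t
      rw [h0, map_zero, mul_eq_zero, or_iff_right (hprod t M)] at this
      exact this
  have : Nontrivial (laurentFunctions K r) :=
    ⟨0, 1, fun h => zero_ne_one (congrFun (congrArg Subtype.val h) 1)⟩
  exact NoZeroDivisors.to_isDomain _

theorem laurentFunctions.isAlgebraic_of_torusCoord [Infinite K] {r : ℕ}
    (B : Subalgebra K (laurentFunctions K r)) (h : ∀ i, IsAlgebraic B (torusCoord K (r := r) i)) :
    Algebra.IsAlgebraic B (laurentFunctions K r) := by
  refine ⟨fun ⟨φ, hφ⟩ => ?_⟩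
  induction hφ using Algebra.adjoin_induction with
  | mem x hx =>
    rcases hx with ⟨i, rfl⟩ | ⟨i, rfl⟩
    · exact h i
    · let : Invertible (torusCoord K (r := r) i) :=
        ⟨⟨_, inv_coord_mem_laurentFunctions i⟩, Subtype.ext (funext fun t => (t i).inv_mul),
          Subtype.ext (funext fun t => (t i).mul_inv)⟩
      exact (h i).invOf
  | algebraMap c => exact isAlgebraic_algebraMap (algebraMap K B c)
  | add x y hx' hy' hx hy => exact hx.add hy
  | mul x y hx' hy' hx hy => exact hx.mul hy

theorem laurentFunctions.trdeg_eq_of_isAlgebraic [Infinite K] {r : ℕ}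
    (B : Subalgebra K (laurentFunctions K r)) (h : ∀ i, IsAlgebraic B (torusCoord K (r := r) i)) :
    Algebra.trdeg K B = r := by
  have key : ∀ B : Subalgebra K (laurentFunctions K r),
      (∀ i, IsAlgebraic B (torusCoord K (r := r) i)) →
        Algebra.trdeg K B = Algebra.trdeg K (laurentFunctions K r) := by
    intro B h
    have := laurentFunctions.isAlgebraic_of_torusCoord B h
    have h2 := trdeg_add_eq K B (A := laurentFunctions K r)
    rwa [trdeg_eq_zero (R := B), add_zero] at h2
  have hinj : Function.Injective (MvPolynomial.aeval (R := K) (torusCoord K (r := r))) := by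
    refine (injective_iff_map_eq_zero _).2 fun p hp => ?_
    refine MvPolynomial.eq_zero_of_eval_torus_eq_zero fun t => ?_
    have h1 := congrArg (fun φ : laurentFunctions K r => φ.1 t) hp
    have h2 : ((Pi.evalAlgHom K (fun _ : Fin r → Kˣ => K) t).comp
        (laurentFunctions K r).val).comp (MvPolynomial.aeval (torusCoord K (r := r))) =
        MvPolynomial.aeval (fun i => (t i : K)) := by
      ext i
      simp [torusCoord]
    exact (DFunLike.congr_fun h2 p).symm.trans h1
  rw [key B h, ← key (MvPolynomial.aeval (R := K) (torusCoord K (r := r))).range,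
    ← (AlgEquiv.ofInjective _ hinj).trdeg_eq]
  · simp
  · intro i
    exact isAlgebraic_algebraMap
      (⟨torusCoord K i, .X i, by simp⟩ : (MvPolynomial.aeval (R := K) (torusCoord K (r := r))).range)

/-- The closure of the image of a torus of dimension `r` under a morphism through which some power
of each coordinate is, generically, a regular function, has dimension `r`. -/
theorem laurentFunctions.ringKrullDim_range [Infinite K] {A : Type*} [CommRing A] [Algebra K A]
    [Algebra.FiniteType K A] {r : ℕ} (ev : A →ₐ[K] laurentFunctions K r)
    (h : ∀ i, ∃ n : ℕ, n ≠ 0 ∧ ∃ a b : A, ev b ≠ 0 ∧ ev b * torusCoord K i ^ n = ev a) :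
    ringKrullDim ev.range = r := by
  have : Algebra.FiniteType K ev.range :=
    .of_surjective ev.rangeRestrict ev.rangeRestrict_surjective
  obtain ⟨n, hn, hn'⟩ := exists_ringKrullDim_eq_trdeg (K := K) (B := ev.range)
  rw [laurentFunctions.trdeg_eq_of_isAlgebraic] at hn'
  · rw [hn, Nat.cast_injective hn']
  · intro i
    obtain ⟨n, hn0, a, b, hb, hab⟩ := h i
    refine IsAlgebraic.of_pow (n := n) (Nat.pos_of_ne_zero hn0) ?_
    refine ⟨.C (ev.rangeRestrict b) * .X - .C (ev.rangeRestrict a), fun h0 => ?_, ?_⟩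
    · have h1 := congrArg (Polynomial.coeff · 1) h0
      simp only [Polynomial.coeff_sub, Polynomial.coeff_C_mul, Polynomial.coeff_X_one, mul_one,
        Polynomial.coeff_C_succ, Polynomial.coeff_zero] at h1
      exact hb ((sub_zero (ev b)).symm.trans (congrArg Subtype.val h1))
    · simp only [map_sub, map_mul, Polynomial.aeval_C, Polynomial.aeval_X]
      exact sub_eq_zero.2 hab

/-- A nontrivial Laurent monomial has no nontrivial power that is trivial. -/
theorem torusCharacter_pow_ne_one [CharZero K] {r : ℕ} {n : Fin r → ℤ}
    (hn : torusCharacter K n ≠ 1) {k : ℕ} (hk : k ≠ 0) :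
    torusCharacter K n ^ k ≠ 1 := by
  obtain ⟨i, hi⟩ : ∃ i, n i ≠ 0 := by
    by_contra! h
    exact hn ((congrArg _ (funext h)).trans torusCharacter_zero)
  intro h
  have h2 : (2 : K) ≠ 0 := two_ne_zero
  have h1 := DFunLike.congr_fun h (Pi.mulSingle i (Units.mk0 2 h2))
  have h3 : torusCharacter K n (Pi.mulSingle i (Units.mk0 2 h2)) = (2 : K) ^ n i := by
    change ((∏ j, (Pi.mulSingle i (Units.mk0 (2 : K) h2) : Fin r → Kˣ) j ^ n j : Kˣ) : K) = _
    rw [Finset.prod_eq_single i (fun j _ hj => by simp [hj]) (by simp)]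
    simp
  rw [MonoidHom.pow_apply, h3, MonoidHom.one_apply, ← zpow_natCast, ← zpow_mul] at h1
  have h4 : (2 : ℚ) ^ (n i * k) = 1 := by
    apply Rat.cast_injective (α := K)
    push_cast
    exact h1
  rw [zpow_eq_one_iff_right₀ (by norm_num) (by norm_num)] at h4
  exact mul_ne_zero hi (Nat.cast_ne_zero.2 hk) h4

end Torus

/-! ### Translations on an algebraic monoid and openness of the group of units -/

section Translations

theorem RingHom.injective_of_surjective_of_isNoetherianRing {R : Type*} [CommRing R]
    [IsNoetherianRing R] (f : R →+* R) (hf : Function.Surjective f) : Function.Injective f := by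
  have hmono : Monotone fun n : ℕ => RingHom.ker (f ^ n) := by
    refine monotone_nat_of_le_succ fun n x hx => ?_
    rw [RingHom.mem_ker, RingHom.coe_pow] at hx ⊢
    rw [Function.iterate_succ_apply', hx, map_zero]
  obtain ⟨n, hn⟩ := monotone_stabilizes_iff_noetherian.2 (inferInstance : IsNoetherian R R)
    ⟨_, hmono⟩
  have hn' : RingHom.ker (f ^ n) = RingHom.ker (f ^ (n + 1)) := hn (n + 1) n.le_succ
  refine (injective_iff_map_eq_zero f).2 fun x hx => ?_
  obtain ⟨y, rfl⟩ := hf.iterate n x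
  rw [← Function.iterate_succ_apply' f, ← RingHom.coe_pow, ← RingHom.mem_ker, ← hn',
    RingHom.mem_ker, RingHom.coe_pow] at hx
  exact hx

variable {K A : Type*} [Field K] [IsAlgClosed K] [CommRing A] [Algebra K A]
  [Algebra.FiniteType K A] [IsDomain A] [Monoid (AffinePoint K A)]

theorem AffinePoint.ext {K A : Type*} [Field K] [CommRing A] [Algebra K A]
    {x y : AffinePoint K A} (h : ∀ f : A, x f = y f) : x = y :=
  AlgHom.ext h

theorem MulIsMorphism.exists_expansion {K A : Type*} [Field K] [CommRing A] [Algebra K A]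
    [Monoid (AffinePoint K A)] (hmul : MulIsMorphism K A) (f : A) :
    ∃ S : Finset (A × A), ∀ x y : AffinePoint K A, (x * y) f = ∑ p ∈ S, x p.1 * y p.2 := by
  obtain ⟨F, hF⟩ := hmul f
  obtain ⟨S, hS⟩ := TensorProduct.exists_finset F
  refine ⟨S, fun x y => ?_⟩
  rw [hF, hS, map_sum]
  exact Finset.sum_congr rfl fun p _ => Algebra.TensorProduct.productMap_apply_tmul _ _ _ _

/-- A map `A → A` that is given by composition with a self-map of the set of points is a
homomorphism of algebras. -/
theorem exists_algHom_of_forall_point {K A : Type*} [Field K] [IsAlgClosed K] [CommRing A]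
    [Algebra K A] [Algebra.FiniteType K A] [IsDomain A]
    (τ : AffinePoint K A → AffinePoint K A)
    (h : ∀ f : A, ∃ g : A, ∀ y : AffinePoint K A, y g = (τ y) f) :
    ∃ φ : A →ₐ[K] A, ∀ (f : A) (y : AffinePoint K A), y (φ f) = (τ y) f := by
  choose φ hφ using h
  refine ⟨⟨⟨⟨⟨φ, ?_⟩, ?_⟩, ?_, ?_⟩, ?_⟩, hφ⟩
  · refine (AffinePoint.funext_iff (K := K)).2 fun y => ?_
    rw [hφ]
    exact (map_one (τ y).toAlgHom).trans (map_one y.toAlgHom).symm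
  · intro a b
    refine (AffinePoint.funext_iff (K := K)).2 fun y => ?_
    rw [hφ]
    refine (map_mul (τ y).toAlgHom a b).trans (.trans ?_ (map_mul y.toAlgHom _ _).symm)
    exact congrArg₂ _ (hφ a y).symm (hφ b y).symm
  · refine (AffinePoint.funext_iff (K := K)).2 fun y => (hφ _ y).trans ?_
    exact (map_zero (τ y).toAlgHom).trans (map_zero y.toAlgHom).symm
  · intro a b
    refine (AffinePoint.funext_iff (K := K)).2 fun y => (hφ _ y).trans ?_
    refine (map_add (τ y).toAlgHom a b).trans (.trans ?_ (map_add y.toAlgHom _ _).symm)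
    exact congrArg₂ _ (hφ a y).symm (hφ b y).symm
  · intro r
    refine (AffinePoint.funext_iff (K := K)).2 fun y => (hφ _ y).trans ?_
    exact ((τ y).toAlgHom.commutes r).trans (y.toAlgHom.commutes r).symm

theorem MulIsMorphism.exists_lTranslate (hmul : MulIsMorphism K A) (x : AffinePoint K A) :
    ∃ φ : A →ₐ[K] A, ∀ (f : A) (y : AffinePoint K A), y (φ f) = (x * y) f := by
  refine exists_algHom_of_forall_point _ fun f => ?_
  obtain ⟨S, hS⟩ := hmul.exists_expansion f
  refine ⟨∑ p ∈ S, x p.1 • p.2, fun y => ?_⟩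
  rw [hS]
  exact (map_sum y.toAlgHom _ _).trans
    (Finset.sum_congr rfl fun p _ => (map_smul y.toAlgHom _ _))

theorem MulIsMorphism.exists_rTranslate (hmul : MulIsMorphism K A) (x : AffinePoint K A) :
    ∃ φ : A →ₐ[K] A, ∀ (f : A) (y : AffinePoint K A), y (φ f) = (y * x) f := by
  refine exists_algHom_of_forall_point _ fun f => ?_
  obtain ⟨S, hS⟩ := hmul.exists_expansion f
  refine ⟨∑ p ∈ S, x p.2 • p.1, fun y => ?_⟩
  rw [hS]
  refine (map_sum y.toAlgHom _ _).trans
    (Finset.sum_congr rfl fun p _ => (map_smul y.toAlgHom _ _).trans ?_)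
  exact mul_comm _ _

/-- Left translation of functions: `f` is sent to the function `y ↦ f (x * y)`. -/
noncomputable def MulIsMorphism.lTranslate (hmul : MulIsMorphism K A) (x : AffinePoint K A) :
    A →ₐ[K] A := (hmul.exists_lTranslate x).choose

/-- Right translation of functions: `f` is sent to the function `y ↦ f (y * x)`. -/
noncomputable def MulIsMorphism.rTranslate (hmul : MulIsMorphism K A) (x : AffinePoint K A) :
    A →ₐ[K] A := (hmul.exists_rTranslate x).choose

theorem MulIsMorphism.apply_lTranslate (hmul : MulIsMorphism K A) (x y : AffinePoint K A) (f : A) :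
    y (hmul.lTranslate x f) = (x * y) f := (hmul.exists_lTranslate x).choose_spec f y

theorem MulIsMorphism.apply_rTranslate (hmul : MulIsMorphism K A) (x y : AffinePoint K A) (f : A) :
    y (hmul.rTranslate x f) = (y * x) f := (hmul.exists_rTranslate x).choose_spec f y

theorem MulIsMorphism.lTranslate_eq_sum (hmul : MulIsMorphism K A) {f : A} {S : Finset (A × A)}
    (hS : ∀ x y : AffinePoint K A, (x * y) f = ∑ p ∈ S, x p.1 * y p.2) (x : AffinePoint K A) :
    hmul.lTranslate x f = ∑ p ∈ S, x p.1 • p.2 := by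
  refine (AffinePoint.funext_iff (K := K)).2 fun y => ?_
  rw [hmul.apply_lTranslate, hS]
  exact ((map_sum y.toAlgHom _ _).trans
    (Finset.sum_congr rfl fun p _ => map_smul y.toAlgHom _ _)).symm

theorem MulIsMorphism.rTranslate_eq_sum (hmul : MulIsMorphism K A) {f : A} {S : Finset (A × A)}
    (hS : ∀ x y : AffinePoint K A, (x * y) f = ∑ p ∈ S, x p.1 * y p.2) (x : AffinePoint K A) :
    hmul.rTranslate x f = ∑ p ∈ S, x p.2 • p.1 := by
  refine (AffinePoint.funext_iff (K := K)).2 fun y => ?_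
  rw [hmul.apply_rTranslate, hS]
  refine ((map_sum y.toAlgHom _ _).trans
    (Finset.sum_congr rfl fun p _ => (map_smul y.toAlgHom _ _).trans ?_)).symm
  exact mul_comm _ _

theorem MulIsMorphism.lTranslate_lTranslate (hmul : MulIsMorphism K A) (x y : AffinePoint K A)
    (f : A) : hmul.lTranslate x (hmul.lTranslate y f) = hmul.lTranslate (y * x) f := by
  refine (AffinePoint.funext_iff (K := K)).2 fun z => ?_
  rw [hmul.apply_lTranslate, hmul.apply_lTranslate, hmul.apply_lTranslate, mul_assoc]

theorem MulIsMorphism.rTranslate_rTranslate (hmul : MulIsMorphism K A) (x y : AffinePoint K A)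
    (f : A) : hmul.rTranslate x (hmul.rTranslate y f) = hmul.rTranslate (x * y) f := by
  refine (AffinePoint.funext_iff (K := K)).2 fun z => ?_
  rw [hmul.apply_rTranslate, hmul.apply_rTranslate, hmul.apply_rTranslate, mul_assoc]

theorem MulIsMorphism.rTranslate_one (hmul : MulIsMorphism K A) (f : A) :
    hmul.rTranslate 1 f = f :=
  (AffinePoint.funext_iff (K := K)).2 fun z => by rw [hmul.apply_rTranslate, mul_one]

/-- If right translation by `x` is onto, then `x` is invertible: a surjective endomorphism of a
noetherian ring is bijective, and evaluating its inverse at `1` gives the inverse of `x`. -/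
theorem MulIsMorphism.isUnit_of_surjective_rTranslate (hmul : MulIsMorphism K A)
    {x : AffinePoint K A} (h : Function.Surjective (hmul.rTranslate x)) : IsUnit x := by
  have : IsNoetherianRing A := Algebra.FiniteType.isNoetherianRing K A
  have hinj : Function.Injective (hmul.rTranslate x) :=
    RingHom.injective_of_surjective_of_isNoetherianRing (hmul.rTranslate x).toRingHom h
  let e := AlgEquiv.ofBijective (hmul.rTranslate x) ⟨hinj, h⟩
  let y : AffinePoint K A := (1 : AffinePoint K A).toAlgHom.comp e.symm.toAlgHom
  have hyx : y * x = 1 := AffinePoint.ext fun f => by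
    rw [← hmul.apply_rTranslate]
    exact congrArg (1 : AffinePoint K A).toAlgHom (e.symm_apply_apply f)
  have hxy : x * y = 1 := by
    refine AffinePoint.ext fun f => ?_
    obtain ⟨g, rfl⟩ := h f
    rw [← mul_one (x * y), mul_assoc, ← one_mul (x * _), mul_one y, ← hmul.apply_rTranslate,
      ← hmul.rTranslate_rTranslate, hmul.rTranslate_rTranslate y x, hyx, hmul.rTranslate_one]
  exact ⟨⟨x, y, hxy, hyx⟩, rfl⟩

/-- The group of units contains a principal open neighbourhood of `1`. The function defining it is
the determinant of right translations on a finite-dimensional space of functions that is stable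
under them and generates the coordinate algebra. -/
theorem MulIsMorphism.exists_isUnit_of_ne_zero (hmul : MulIsMorphism K A) :
    ∃ d : A, (1 : AffinePoint K A) d ≠ 0 ∧ ∀ x : AffinePoint K A, x d ≠ 0 → IsUnit x := by
  obtain ⟨s, hs⟩ := (inferInstance : Algebra.FiniteType K A).out
  choose S hS using hmul.exists_expansion
  have hr : ∀ (x : AffinePoint K A) (f : A), hmul.rTranslate x f = ∑ p ∈ S f, x p.2 • p.1 :=
    fun x f => hmul.rTranslate_eq_sum (hS f) x
  let V : Submodule K A :=
    Submodule.span K (⋃ f ∈ s, Set.range fun x : AffinePoint K A => hmul.rTranslate x f)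
  have hVfin : Module.Finite K V := by
    let W : Submodule K A := Submodule.span K (⋃ f ∈ s, Prod.fst '' (S f : Set (A × A)))
    have hWfin : Module.Finite K W := Module.Finite.span_of_finite K
      (s.finite_toSet.biUnion fun f _ => (S f).finite_toSet.image _)
    have hVW : V ≤ W := by
      refine Submodule.span_le.2 (Set.iUnion₂_subset fun f hf => ?_)
      rintro _ ⟨x, rfl⟩
      change hmul.rTranslate x f ∈ W
      rw [hr]
      exact Submodule.sum_mem _ fun p hp => Submodule.smul_mem _ _
        (Submodule.subset_span (Set.mem_biUnion hf ⟨p, hp, rfl⟩))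
    exact Submodule.finiteDimensional_of_le hVW
  have hVstab : ∀ (x : AffinePoint K A), ∀ v ∈ V, hmul.rTranslate x v ∈ V := by
    intro x v hv
    suffices h : V ≤ V.comap (hmul.rTranslate x).toLinearMap from h hv
    refine Submodule.span_le.2 (Set.iUnion₂_subset fun f hf => ?_)
    rintro _ ⟨y, rfl⟩
    change hmul.rTranslate x (hmul.rTranslate y f) ∈ V
    rw [hmul.rTranslate_rTranslate]
    exact Submodule.subset_span (Set.mem_biUnion hf ⟨_, rfl⟩)
  have hsV : ∀ f ∈ s, f ∈ V := fun f hf =>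
    Submodule.subset_span (Set.mem_biUnion hf ⟨1, hmul.rTranslate_one f⟩)
  let ρ : AffinePoint K A → V →ₗ[K] V := fun x =>
    (hmul.rTranslate x).toLinearMap.restrict (hVstab x)
  let b := Module.finBasis K V
  choose φ hφ using fun i => LinearMap.exists_extend (b.coord i)
  let m : Matrix (Fin (Module.finrank K V)) (Fin (Module.finrank K V)) A :=
    .of fun i j => ∑ p ∈ S (b j : A), φ i p.1 • p.2
  have hm : ∀ x : AffinePoint K A, m.map x.toAlgHom = LinearMap.toMatrix b b (ρ x) := by
    intro x
    ext i j
    rw [LinearMap.toMatrix_apply]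
    have h1 : b.repr (ρ x (b j)) i = φ i (hmul.rTranslate x (b j)) :=
      (LinearMap.congr_fun (hφ i) (ρ x (b j))).symm
    rw [h1, hr, map_sum]
    refine (map_sum x.toAlgHom _ _).trans (Finset.sum_congr rfl fun p _ => ?_)
    rw [map_smul, map_smul]
    exact mul_comm _ _
  have hdet : ∀ x : AffinePoint K A, x m.det = LinearMap.det (ρ x) := by
    intro x
    rw [← LinearMap.det_toMatrix b, ← hm]
    exact x.toAlgHom.map_det m
  refine ⟨m.det, ?_, fun x hx => ?_⟩
  · have : ρ 1 = LinearMap.id :=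
      LinearMap.ext fun v => Subtype.ext (hmul.rTranslate_one (v : A))
    rw [hdet, this, LinearMap.det_id]
    exact one_ne_zero
  · rw [hdet] at hx
    have hsurj : Function.Surjective (ρ x) :=
      (LinearMap.equivOfDetNeZero (ρ x) hx).surjective
    refine hmul.isUnit_of_surjective_rTranslate ((AlgHom.range_eq_top _).1 (top_le_iff.1 ?_))
    rw [← hs, Algebra.adjoin_le_iff]
    intro f hf
    obtain ⟨v, hv⟩ := hsurj ⟨f, hsV f hf⟩
    exact ⟨v, congrArg Subtype.val hv⟩

/-- The dimension of the group of units is the dimension of the monoid. -/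
theorem MulIsMorphism.topologicalKrullDim_units (hmul : MulIsMorphism K A) :
    topologicalKrullDim {x : AffinePoint K A // IsUnit x} = ringKrullDim A := by
  refine le_antisymm ?_ ?_
  · rw [← AffinePoint.topologicalKrullDim_eq (K := K)]
    exact topologicalKrullDim_subspace_le _ {x : AffinePoint K A | IsUnit x}
  · obtain ⟨d, hd1, hd⟩ := hmul.exists_isUnit_of_ne_zero
    have hd0 : d ≠ 0 := by
      rintro rfl
      exact hd1 (map_zero (1 : AffinePoint K A).toAlgHom)
    have hle : Submonoid.powers d ≤ nonZeroDivisors A :=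
      powers_le_nonZeroDivisors_of_noZeroDivisors hd0
    let C := Localization.Away d
    have : IsDomain C := IsLocalization.isDomain_of_le_nonZeroDivisors C hle
    have : Algebra.FiniteType A C := IsLocalization.finiteType_of_monoid_fg (.powers d) C
    have : Algebra.FiniteType K C := Algebra.FiniteType.trans (S := A) inferInstance inferInstance
    have : FaithfulSMul A C := (faithfulSMul_iff_algebraMap_injective _ _).2
      (IsLocalization.injective C hle)
    have : Algebra.IsAlgebraic A C := IsLocalization.isAlgebraic (R := A) C (.powers d)
    have hdim : ringKrullDim A = ringKrullDim C := by
      obtain ⟨n, hn, hn'⟩ := exists_ringKrullDim_eq_trdeg (K := K) (B := A)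
      obtain ⟨k, hk, hk'⟩ := exists_ringKrullDim_eq_trdeg (K := K) (B := C)
      have h := trdeg_add_eq K A (A := C)
      rw [trdeg_eq_zero (R := A) (A := C), add_zero, hn', hk'] at h
      rw [hn, hk, Nat.cast_injective h]
    rw [hdim, ← AffinePoint.topologicalKrullDim_eq (K := K)]
    have hind := AffinePoint.isInducing_comp_of_isLocalization (K := K) (B := A) (C := C)
      (.powers d)
    have hu : ∀ y : AffinePoint K C,
        y.toAlgHom.comp (IsScalarTower.toAlgHom K A C) ∈ {x : AffinePoint K A | IsUnit x} :=
      fun y => hd _ ((IsLocalization.Away.algebraMap_isUnit (S := C) d).map y.toAlgHom).ne_zero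
    exact (hind.codRestrict hu).topologicalKrullDim_le

end Translations

/-! ### Invariant derivations and commutativity -/

section InvariantDerivations

variable {K A : Type*} [Field K] [IsAlgClosed K] [CommRing A] [Algebra K A]
  [Algebra.FiniteType K A] [IsDomain A] [Monoid (AffinePoint K A)]

/-- If the functions `x ↦ δ (φ x f)`, for a family `φ` of endomorphisms of the algebra and a tangent
vector `δ` at `1`, are regular, then they are the values of a derivation. -/
theorem exists_derivation_of_pointDerivation (φ : AffinePoint K A → A →ₐ[K] A)
    (hφ : ∀ x f, (1 : AffinePoint K A) (φ x f) = x f) (δ : A →ₗ[K] K)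
    (hδ : ∀ a b, δ (a * b) = (1 : AffinePoint K A) a * δ b + (1 : AffinePoint K A) b * δ a)
    (hex : ∀ f : A, ∃ g : A, ∀ x : AffinePoint K A, x g = δ (φ x f)) :
    ∃ L : Derivation K A A, ∀ (x : AffinePoint K A) f, x (L f) = δ (φ x f) := by
  choose L hL using hex
  refine ⟨.mk' ⟨⟨L, fun a b => ?_⟩, fun r a => ?_⟩ fun a b => ?_, fun x f => hL f x⟩
  · refine (AffinePoint.funext_iff (K := K)).2 fun x => ?_
    rw [hL, map_add, map_add, ← hL, ← hL]
    exact (map_add x.toAlgHom _ _).symm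
  · refine (AffinePoint.funext_iff (K := K)).2 fun x => ?_
    change x (L (r • a)) = x (r • L a)
    rw [hL, map_smul, map_smul, ← hL]
    exact (map_smul x.toAlgHom _ _).symm
  · refine (AffinePoint.funext_iff (K := K)).2 fun x => ?_
    change x (L (a * b)) = x (a * L b + b * L a)
    rw [hL, map_mul, hδ, hφ, hφ, ← hL, ← hL]
    exact ((map_add x.toAlgHom _ _).trans
      (congrArg₂ _ (map_mul x.toAlgHom _ _) (map_mul x.toAlgHom _ _))).symm

/-- The left invariant vector field with value `δ` at `1`. -/
theorem MulIsMorphism.exists_leftInvariant (hmul : MulIsMorphism K A) (δ : A →ₗ[K] K)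
    (hδ : ∀ a b, δ (a * b) = (1 : AffinePoint K A) a * δ b + (1 : AffinePoint K A) b * δ a) :
    ∃ L : Derivation K A A, ∀ (x : AffinePoint K A) f, x (L f) = δ (hmul.lTranslate x f) := by
  refine exists_derivation_of_pointDerivation hmul.lTranslate
    (fun x f => by rw [hmul.apply_lTranslate, mul_one]) δ hδ fun f => ?_
  obtain ⟨S, hS⟩ := hmul.exists_expansion f
  refine ⟨∑ p ∈ S, δ p.2 • p.1, fun x => ?_⟩
  rw [hmul.lTranslate_eq_sum hS, map_sum]
  refine (map_sum x.toAlgHom _ _).trans (Finset.sum_congr rfl fun p _ => ?_)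
  rw [map_smul, map_smul]
  exact mul_comm _ _

/-- The right invariant vector field with value `δ` at `1`. -/
theorem MulIsMorphism.exists_rightInvariant (hmul : MulIsMorphism K A) (δ : A →ₗ[K] K)
    (hδ : ∀ a b, δ (a * b) = (1 : AffinePoint K A) a * δ b + (1 : AffinePoint K A) b * δ a) :
    ∃ R : Derivation K A A, ∀ (x : AffinePoint K A) f, x (R f) = δ (hmul.rTranslate x f) := by
  refine exists_derivation_of_pointDerivation hmul.rTranslate
    (fun x f => by rw [hmul.apply_rTranslate, one_mul]) δ hδ fun f => ?_
  obtain ⟨S, hS⟩ := hmul.exists_expansion f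
  refine ⟨∑ p ∈ S, δ p.1 • p.2, fun x => ?_⟩
  rw [hmul.rTranslate_eq_sum hS, map_sum]
  refine (map_sum x.toAlgHom _ _).trans (Finset.sum_congr rfl fun p _ => ?_)
  rw [map_smul, map_smul]
  exact mul_comm _ _

/-- Left and right invariant vector fields commute. -/
theorem MulIsMorphism.leftInvariant_comm_rightInvariant (hmul : MulIsMorphism K A)
    {δ δ' : A →ₗ[K] K} {L R : Derivation K A A}
    (hL : ∀ (x : AffinePoint K A) f, x (L f) = δ (hmul.lTranslate x f))
    (hR : ∀ (x : AffinePoint K A) f, x (R f) = δ' (hmul.rTranslate x f)) (f : A) :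
    L (R f) = R (L f) := by
  obtain ⟨S, hS⟩ := hmul.exists_expansion f
  have hRf : R f = ∑ p ∈ S, δ' p.1 • p.2 := by
    refine (AffinePoint.funext_iff (K := K)).2 fun z => ?_
    rw [hR, hmul.rTranslate_eq_sum hS, map_sum]
    refine ((map_sum z.toAlgHom _ _).trans (Finset.sum_congr rfl fun p _ => ?_)).symm
    rw [map_smul, map_smul]
    exact mul_comm _ _
  refine (AffinePoint.funext_iff (K := K)).2 fun x => ?_
  have hrL : hmul.rTranslate x (L f) = ∑ p ∈ S, x (L p.2) • p.1 := by
    refine (AffinePoint.funext_iff (K := K)).2 fun z => ?_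
    rw [hmul.apply_rTranslate, hL, ← hmul.lTranslate_lTranslate, hmul.lTranslate_eq_sum hS, map_sum,
      map_sum]
    refine ((map_sum z.toAlgHom _ _).trans (Finset.sum_congr rfl fun p _ => ?_)).symm
    rw [map_smul, map_smul, map_smul, hL]
    exact mul_comm _ _
  rw [hR, hrL, hRf, map_sum, map_sum]
  refine (map_sum x.toAlgHom _ _).trans (Finset.sum_congr rfl fun p _ => ?_)
  rw [Derivation.map_smul, map_smul, map_smul]
  exact mul_comm _ _

/-- If the subvariety `V(P)` of codimension one is the closure of a central subgroup `T` of the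
group of units, then the monoid is commutative. Choose a tangent vector `δ` at `1` that is
transversal to `V(P)`. The left and right invariant vector fields `L`, `R` extending it agree along
`T` and commute, so rigidity applied to `L - R` gives `L = R`. Thus `L` commutes with all left and
right translations, and rigidity applied to their differences shows that these agree. -/
theorem MulIsMorphism.commute_of_central_codim_one [CharZero K] (hmul : MulIsMorphism K A)
    (T : Subgroup (AffinePoint K A)ˣ) (P : Ideal A) [P.IsPrime]
    [IsDiscreteValuationRing (Localization.AtPrime P)]
    (hP : ∀ g, g ∈ P ↔ ∀ t ∈ T, (t : AffinePoint K A) g = 0)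
    (hcentral : ∀ t ∈ T, ∀ x : AffinePoint K A, (t : AffinePoint K A) * x = x * t)
    (x y : AffinePoint K A) : x * y = y * x := by
  obtain ⟨f, hf⟩ := exists_isUniformizerAt P
  obtain ⟨_, ⟨t, ht, rfl⟩, δ, hδ, hδf⟩ := hf.exists_pointDerivation (K := K)
    {x | ∃ t ∈ T, (t : AffinePoint K A) = x} (fun g => by rw [hP]; simp)
  -- translate the tangent vector from `t` to `1`
  let δ₁ : A →ₗ[K] K := δ ∘ₗ (hmul.lTranslate (t⁻¹ : (AffinePoint K A)ˣ)).toLinearMap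
  have hδ₁ : ∀ a b, δ₁ (a * b) =
      (1 : AffinePoint K A) a * δ₁ b + (1 : AffinePoint K A) b * δ₁ a := by
    intro a b
    change δ (hmul.lTranslate _ (a * b)) = _
    rw [map_mul, hδ, hmul.apply_lTranslate, hmul.apply_lTranslate, Units.inv_mul]
    rfl
  have hg : hmul.lTranslate t f ∈ P := (hP _).2 fun t' ht' => by
    rw [hmul.apply_lTranslate, ← Units.val_mul]
    exact (hP f).1 hf.mem _ (T.mul_mem ht ht')
  have hδg : δ₁ (hmul.lTranslate t f) ≠ 0 := by
    change δ (hmul.lTranslate _ (hmul.lTranslate _ f)) ≠ 0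
    rw [hmul.lTranslate_lTranslate, Units.mul_inv]
    rwa [show hmul.lTranslate 1 f = f from
      (AffinePoint.funext_iff (K := K)).2 fun z => by rw [hmul.apply_lTranslate, one_mul]]
  obtain ⟨L, hL⟩ := hmul.exists_leftInvariant δ₁ hδ₁
  obtain ⟨R, hR⟩ := hmul.exists_rightInvariant δ₁ hδ₁
  have hLg : L (hmul.lTranslate t f) ∉ P := fun h => hδg <| by
    have := (hP _).1 h 1 T.one_mem
    rw [Units.val_one, hL, hmul.lTranslate_lTranslate, mul_one] at this
    exact this
  have hlr : ∀ t' ∈ T, ∀ a, hmul.lTranslate (t' : AffinePoint K A) a = hmul.rTranslate t' a :=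
    fun t' ht' a => (AffinePoint.funext_iff (K := K)).2 fun z => by
      rw [hmul.apply_lTranslate, hmul.apply_rTranslate, hcentral t' ht']
  have hLR : ∀ a, L a = R a := fun a => sub_eq_zero.1 <|
    eq_zero_of_commute_derivation L hg hLg (fun a => L a - R a)
      (fun a => (hP _).2 fun t' ht' => (map_sub t'.1.toAlgHom _ _).trans <| sub_eq_zero.2 <| by
        have := (hL t' a).trans ((congrArg δ₁ (hlr t' ht' a)).trans (hR t' a).symm)
        exact this)
      (fun a => by
        rw [map_sub, hmul.leftInvariant_comm_rightInvariant hL hR]) a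
  have hLl : ∀ a, L (hmul.lTranslate y a) = hmul.lTranslate y (L a) := fun a =>
    (AffinePoint.funext_iff (K := K)).2 fun z => by
      rw [hL, hmul.lTranslate_lTranslate, hmul.apply_lTranslate, hL]
  have hLr : ∀ a, L (hmul.rTranslate y a) = hmul.rTranslate y (L a) := fun a =>
    (AffinePoint.funext_iff (K := K)).2 fun z => by
      rw [hLR, hLR, hR, hmul.rTranslate_rTranslate, hmul.apply_rTranslate, hR]
  have hE : ∀ a, hmul.rTranslate y a - hmul.lTranslate y a = 0 :=
    eq_zero_of_commute_derivation L hg hLg (fun a => hmul.rTranslate y a - hmul.lTranslate y a)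
      (fun a => (hP _).2 fun t' ht' => (map_sub t'.1.toAlgHom _ _).trans <| sub_eq_zero.2 <| by
        have := (hmul.apply_rTranslate y t' a).trans
          ((congrArg (fun w : AffinePoint K A => w a) (hcentral t' ht' y)).trans
            (hmul.apply_lTranslate y t' a).symm)
        exact this)
      (fun a => by rw [map_sub, hLl, hLr])
  refine AffinePoint.ext fun a => ?_
  rw [← hmul.apply_rTranslate, ← hmul.apply_lTranslate, sub_eq_zero.1 (hE a)]

end InvariantDerivations

/-! ### Weights of a torus acting by conjugation -/

section Weights

variable {K A : Type*} [Field K] [IsAlgClosed K] [CommRing A] [Algebra K A]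
  [Algebra.FiniteType K A] [IsDomain A] [Monoid (AffinePoint K A)]

/-- The action of an invertible element `g` on functions by conjugation: `f` is sent to the function
`x ↦ f (g * x * g⁻¹)`. -/
noncomputable def MulIsMorphism.conj (hmul : MulIsMorphism K A) (g : (AffinePoint K A)ˣ) :
    A →ₐ[K] A :=
  (hmul.rTranslate (g⁻¹ : (AffinePoint K A)ˣ)).comp (hmul.lTranslate g)

theorem MulIsMorphism.apply_conj (hmul : MulIsMorphism K A) (g : (AffinePoint K A)ˣ)
    (x : AffinePoint K A) (f : A) : x (hmul.conj g f) = (g * x * (g⁻¹ : (AffinePoint K A)ˣ)) f := by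
  change x (hmul.rTranslate _ (hmul.lTranslate _ f)) = _
  rw [hmul.apply_rTranslate, hmul.apply_lTranslate, mul_assoc]

theorem MulIsMorphism.conj_conj (hmul : MulIsMorphism K A) (g h : (AffinePoint K A)ˣ) (f : A) :
    hmul.conj g (hmul.conj h f) = hmul.conj (h * g) f := by
  refine (AffinePoint.funext_iff (K := K)).2 fun x => ?_
  rw [hmul.apply_conj, hmul.apply_conj, hmul.apply_conj, mul_inv_rev]
  simp only [Units.val_mul, mul_assoc]

theorem MulIsMorphism.apply_conj_of_commute (hmul : MulIsMorphism K A) {g : (AffinePoint K A)ˣ}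
    {x : AffinePoint K A} (h : (g : AffinePoint K A) * x = x * g) (f : A) :
    x (hmul.conj g f) = x f := by
  rw [hmul.apply_conj, h, mul_assoc, Units.mul_inv, mul_one]

theorem MulIsMorphism.commute_of_conj_eq (hmul : MulIsMorphism K A) {g : (AffinePoint K A)ˣ}
    (h : ∀ f, hmul.conj g f = f) (x : AffinePoint K A) :
    (g : AffinePoint K A) * x = x * g := by
  rw [← Units.mul_inv_eq_iff_eq_mul]
  exact AffinePoint.ext fun f => by rw [← hmul.apply_conj, h]

variable {r : ℕ} (e : (Fin r → Kˣ) →* (AffinePoint K A)ˣ)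

/-- `f` is a weight vector of weight `ψ` for the action by conjugation of the torus `e`. -/
def MulIsMorphism.IsWeightVector (hmul : MulIsMorphism K A) (ψ : (Fin r → Kˣ) →* K) (f : A) :
    Prop :=
  ∀ t, hmul.conj (e t) f = ψ t • f

/-- Every function is a sum of weight vectors: `t ↦ f (e t * x * (e t)⁻¹)` is a Laurent function
of `t`, and the components are its coefficients. -/
theorem MulIsMorphism.exists_weight_decomposition (hmul : MulIsMorphism K A)
    (he : ∀ f : A, (fun t => (e t : AffinePoint K A) f) ∈ laurentFunctions K r) (f : A) :
    ∃ c : ((Fin r → Kˣ) →* K) →₀ A,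
      (∀ ψ ∈ c.support, (∃ n, ψ = torusCharacter K n) ∧ hmul.IsWeightVector e ψ (c ψ)) ∧
      f = ∑ ψ ∈ c.support, c ψ := by
  have hspan : ∀ {φ : (Fin r → Kˣ) → K}, φ ∈ laurentFunctions K r → ∀ a : A,
      (fun t => φ t • a) ∈ Submodule.span K
        {F : (Fin r → Kˣ) → A | ∃ n a, F = fun t => torusCharacter K n t • a} := by
    intro φ hφ a
    replace hφ := laurentFunctions_le_span_torusCharacter hφ
    induction hφ using Submodule.span_induction with
    | mem x hx =>
      obtain ⟨n, rfl⟩ := hx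
      exact Submodule.subset_span ⟨n, a, rfl⟩
    | zero =>
      convert! Submodule.zero_mem _ using 1
      exact funext fun t => zero_smul K a
    | add x y _ _ hx hy =>
      convert! Submodule.add_mem _ hx hy using 1
      exact funext fun t => add_smul _ _ a
    | smul b x _ hx =>
      convert! Submodule.smul_mem _ b hx using 1
      exact funext fun t => smul_assoc b (x t) a
  have hmem : (fun t => hmul.conj (e t) f) ∈ Submodule.span K
      {F : (Fin r → Kˣ) → A | ∃ n a, F = fun t => torusCharacter K n t • a} := by
    choose S hS using hmul.exists_expansion
    have : (fun t => hmul.conj (e t) f) = ∑ p ∈ S f, ∑ q ∈ S p.2, fun t =>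
        ((e t : AffinePoint K A) p.1 * (e t⁻¹ : AffinePoint K A) q.2) • q.1 := by
      funext t
      simp only [Finset.sum_apply]
      change hmul.rTranslate _ (hmul.lTranslate _ f) = _
      rw [hmul.lTranslate_eq_sum (hS f), map_sum]
      refine Finset.sum_congr rfl fun p _ => ?_
      rw [map_smul, hmul.rTranslate_eq_sum (hS p.2), Finset.smul_sum]
      refine Finset.sum_congr rfl fun q _ => ?_
      rw [smul_smul, map_inv]
    rw [this]
    exact Submodule.sum_mem _ fun p _ => Submodule.sum_mem _ fun q _ =>
      hspan ((laurentFunctions K r).mul_mem (he p.1) (comp_inv_mem_laurentFunctions (he q.2))) q.1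
  have hfin : ∀ F ∈ Submodule.span K
      {F : (Fin r → Kˣ) → A | ∃ n a, F = fun t => torusCharacter K n t • a},
      ∃ c : ((Fin r → Kˣ) →* K) →₀ A, (∀ ψ ∈ c.support, ∃ n, ψ = torusCharacter K n) ∧
        ∀ t, F t = c.sum fun ψ a => ψ t • a := by
    classical
    intro F hF
    induction hF using Submodule.span_induction with
    | mem x hx =>
      obtain ⟨n, a, rfl⟩ := hx
      refine ⟨.single (torusCharacter K n) a, fun ψ hψ => ⟨n, ?_⟩, fun t => ?_⟩
      · exact Finset.mem_singleton.1 (Finsupp.support_single_subset hψ)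
      · exact (Finsupp.sum_single_index (h := fun (ψ : (Fin r → Kˣ) →* K) (a : A) => ψ t • a)
           (smul_zero _)).symm
    | zero => exact ⟨0, by simp, fun t => by simp⟩
    | add x y _ _ hx hy =>
      obtain ⟨c, hc, hc'⟩ := hx
      obtain ⟨d, hd, hd'⟩ := hy
      refine ⟨c + d, fun ψ hψ => ?_, fun t => ?_⟩
      · exact (Finset.mem_union.1 (Finsupp.support_add hψ)).elim (hc ψ) (hd ψ)
      · rw [Finsupp.sum_add_index' (fun _ => smul_zero _) (fun _ _ _ => smul_add _ _ _), ← hc',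
          ← hd', Pi.add_apply]
    | smul b x _ hx =>
      obtain ⟨c, hc, hc'⟩ := hx
      refine ⟨b • c, fun ψ hψ => hc ψ (Finsupp.support_smul hψ), fun t => ?_⟩
      rw [Finsupp.sum_smul_index' (fun _ => smul_zero _), Pi.smul_apply, hc', Finsupp.smul_sum]
      exact Finset.sum_congr rfl fun ψ _ => smul_comm _ _ _
  obtain ⟨c, hc, hcf⟩ := hfin _ hmem
  refine ⟨c, fun ψ hψ => ⟨hc ψ hψ, fun s => ?_⟩, ?_⟩
  · refine (AffinePoint.funext_iff (K := K)).2 fun x => ?_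
    -- compare the coefficients of the characters in `conj (e s) (conj (e t) f) = conj (e (t s)) f`
    have h0 : ∑ ψ ∈ c.support, (x (hmul.conj (e s) (c ψ)) - ψ s * x (c ψ)) •
        (ψ : (Fin r → Kˣ) → K) = 0 := by
      funext t
      have h1 := congrArg x.toAlgHom (hmul.conj_conj (e s) (e t) f)
      rw [← map_mul, hcf t, hcf (t * s), Finsupp.sum, Finsupp.sum, map_sum, map_sum, map_sum,
        ← sub_eq_zero, ← Finset.sum_sub_distrib] at h1
      rw [Finset.sum_apply, Pi.zero_apply, ← h1]
      refine Finset.sum_congr rfl fun ψ _ => ?_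
      rw [map_smul, map_smul, map_smul, map_mul, Pi.smul_apply, smul_eq_mul, smul_eq_mul,
        smul_eq_mul]
      ring
    have h2 := linearIndependent_iff'.1 (linearIndependent_monoidHom (Fin r → Kˣ) K) c.support
      (fun ψ => x (hmul.conj (e s) (c ψ)) - ψ s * x (c ψ)) h0 ψ hψ
    exact (sub_eq_zero.1 h2).trans (map_smul x.toAlgHom _ _).symm
  · have h := hcf 1
    rw [map_one] at h
    rw [← show hmul.conj 1 f = f from (AffinePoint.funext_iff (K := K)).2 fun x => by
      rw [hmul.apply_conj_of_commute (by simp)], h]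
    exact Finset.sum_congr rfl fun ψ _ => by simp only [map_one, one_smul]

variable {P : Ideal A}

/-- Conjugation by the torus does not change functions along the torus. -/
theorem MulIsMorphism.apply_torus_conj (hmul : MulIsMorphism K A) (s t : Fin r → Kˣ) (f : A) :
    (e s : AffinePoint K A) (hmul.conj (e t) f) = (e s : AffinePoint K A) f :=
  hmul.apply_conj_of_commute (by rw [← Units.val_mul, ← Units.val_mul, ← map_mul, mul_comm t,
    map_mul]) f

theorem MulIsMorphism.IsWeightVector.mem_of_ne_one {hmul : MulIsMorphism K A}
    {ψ : (Fin r → Kˣ) →* K} {f : A} (hf : hmul.IsWeightVector e ψ f) (hψ : ψ ≠ 1)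
    (hP : ∀ g, g ∈ P ↔ ∀ t, (e t : AffinePoint K A) g = 0) : f ∈ P := by
  obtain ⟨t, ht⟩ := DFunLike.ne_iff.1 hψ
  refine (hP f).2 fun s => ?_
  have h := hmul.apply_torus_conj e s t f
  rw [hf t] at h
  have h' : ψ t * (e s : AffinePoint K A) f = (e s : AffinePoint K A) f :=
    (map_smul (e s : AffinePoint K A).toAlgHom _ _).symm.trans h
  by_contra h0
  exact ht ((mul_eq_right₀ h0).1 h')

/-- The weight components of a function that vanishes on the torus vanish on the torus. -/
theorem MulIsMorphism.weight_component_mem {hmul : MulIsMorphism K A}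
    (hP : ∀ g, g ∈ P ↔ ∀ t, (e t : AffinePoint K A) g = 0) {c : ((Fin r → Kˣ) →* K) →₀ A}
    (hc : ∀ ψ ∈ c.support, hmul.IsWeightVector e ψ (c ψ))
    (hsum : ∑ ψ ∈ c.support, c ψ ∈ P) {ψ : (Fin r → Kˣ) →* K} (hψ : ψ ∈ c.support) : c ψ ∈ P := by
  classical
  by_cases h1 : ψ = 1
  · subst h1
    rw [← Finset.add_sum_erase _ _ hψ] at hsum
    refine (Ideal.add_mem_iff_left P (P.sum_mem fun ψ' hψ' => ?_)).1 hsum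
    exact (hc ψ' (Finset.mem_of_mem_erase hψ')).mem_of_ne_one e (Finset.ne_of_mem_erase hψ') hP
  · exact (hc ψ hψ).mem_of_ne_one e h1 hP

variable [P.IsPrime]

/-- The local parameter along the closure of the torus may be chosen to be a weight vector. -/
theorem MulIsMorphism.exists_weightVector_isUniformizerAt
    [IsDiscreteValuationRing (Localization.AtPrime P)] (hmul : MulIsMorphism K A)
    (he : ∀ f : A, (fun t => (e t : AffinePoint K A) f) ∈ laurentFunctions K r)
    (hP : ∀ g, g ∈ P ↔ ∀ t, (e t : AffinePoint K A) g = 0) :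
    ∃ n f, IsUniformizerAt P f ∧ hmul.IsWeightVector e (torusCharacter K n) f := by
  obtain ⟨f, hf⟩ := exists_isUniformizerAt P
  obtain ⟨c, hc, hsum⟩ := hmul.exists_weight_decomposition e he f
  let J : Ideal A := (IsLocalRing.maximalIdeal (Localization.AtPrime P) ^ 2).comap
    (algebraMap A (Localization.AtPrime P))
  have hm := hf.maximalIdeal_eq
  have hfJ : f ∉ J := by
    intro h
    change algebraMap A (Localization.AtPrime P) f ∈
      IsLocalRing.maximalIdeal (Localization.AtPrime P) ^ 2 at h
    rw [hm, Ideal.span_singleton_pow, Ideal.mem_span_singleton] at h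
    exact hf.not_isUnit (isUnit_of_dvd_one ((mul_dvd_mul_iff_left hf.ne_zero).1
      (by rwa [mul_one, ← pow_two])))
  obtain ⟨ψ, hψ, hψJ⟩ : ∃ ψ ∈ c.support, c ψ ∉ J := by
    by_contra! h
    exact hfJ (hsum ▸ J.sum_mem h)
  have hψP : c ψ ∈ P := MulIsMorphism.weight_component_mem e hP (fun ψ hψ => (hc ψ hψ).2)
    (hsum ▸ hf.mem) hψ
  obtain ⟨n, hn⟩ := (hc ψ hψ).1
  refine ⟨n, c ψ, ?_, hn ▸ (hc ψ hψ).2⟩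
  obtain ⟨k, hk⟩ := hf.exists_hasOrder (Finsupp.mem_support_iff.1 hψ)
  have hk0 := hk.pos_of_mem hψP
  obtain rfl | hk2 : k = 1 ∨ 2 ≤ k := by lia
  · exact hf.of_hasOrder_one hk
  · refine absurd ?_ hψJ
    obtain ⟨s, u, hs, hu, h⟩ := hk
    change algebraMap A (Localization.AtPrime P) (c ψ) ∈
      IsLocalRing.maximalIdeal (Localization.AtPrime P) ^ 2
    rw [← Ideal.unit_mul_mem_iff_mem _ ((isUnit_algebraMap_localization_iff P).2 hs), ← map_mul, h,
      map_mul, map_pow]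
    refine Ideal.mul_mem_left _ _ (Ideal.pow_le_pow_right hk2 (Ideal.pow_mem_pow ?_ k))
    exact hm ▸ Ideal.mem_span_singleton_self _

/-- The order of vanishing along the torus determines the weight: if the local parameter `f` has
weight `χ`, a weight vector vanishing to order `k` has weight `χ ^ k`. Indeed, its quotient by
`f ^ k` restricts to a nonzero rational function on the torus, on which conjugation is trivial. -/
theorem MulIsMorphism.IsWeightVector.eq_pow {hmul : MulIsMorphism K A}
    {χ ψ : (Fin r → Kˣ) →* K} {f g : A} (hψ : hmul.IsWeightVector e ψ g)
    (hP : ∀ g, g ∈ P ↔ ∀ t, (e t : AffinePoint K A) g = 0) (hf : IsUniformizerAt P f)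
    (hχ : hmul.IsWeightVector e χ f) {k : ℕ} (hk : HasOrder P f g k) : ψ = χ ^ k := by
  obtain ⟨s, u, hs, hu, h⟩ := hk
  have hf0 : f ≠ 0 := by
    rintro rfl
    exact hf.ne_zero (map_zero _)
  have hsu : s * u ∉ P := Ideal.IsPrime.mul_notMem inferInstance hs hu
  rw [hP] at hsu
  push Not at hsu
  obtain ⟨t', ht'⟩ := hsu
  refine MonoidHom.ext fun t => ?_
  have h1 := congrArg (hmul.conj (e t)) h
  rw [map_mul, map_mul, map_pow, hψ t, hχ t, smul_pow] at h1
  have h2 : (ψ t • (hmul.conj (e t) s * u)) * f ^ k =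
      (χ t ^ k • (s * hmul.conj (e t) u)) * f ^ k := by
    simp only [Algebra.smul_def] at h1 ⊢
    linear_combination s * h1 - algebraMap K A (ψ t) * hmul.conj (e t) s * h
  have h3 := congrArg (e t' : AffinePoint K A).toAlgHom (mul_right_cancel₀ (pow_ne_zero k hf0) h2)
  rw [map_smul, map_smul, map_mul, map_mul] at h3
  have h4 : ∀ a, (e t' : AffinePoint K A).toAlgHom (hmul.conj (e t) a) =
    (e t' : AffinePoint K A).toAlgHom a := hmul.apply_torus_conj e t' t
  rw [h4, h4, ← map_mul] at h3
  exact mul_right_cancel₀ ht' h3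

end Weights

/-! ### Dimension of subsets of an affine variety -/

section SubsetDimension

variable {K B : Type*} [Field K] [IsAlgClosed K] [CommRing B] [Algebra K B] [Algebra.FiniteType K B]

theorem AffinePoint.topologicalKrullDim_le_of_vanish (I : Ideal B) (S : Set (AffinePoint K B))
    (h : ∀ x ∈ S, ∀ f ∈ I, x f = 0) : topologicalKrullDim S ≤ ringKrullDim (B ⧸ I) := by
  rw [← AffinePoint.topologicalKrullDim_eq (K := K) (B := B ⧸ I)]
  have hind := AffinePoint.isInducing_comp_of_surjective (Ideal.Quotient.mkₐ K I)
    (Ideal.Quotient.mkₐ_surjective K I)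
  let k : S → AffinePoint K (B ⧸ I) := fun x => Ideal.Quotient.liftₐ I x.1.toAlgHom (h x.1 x.2)
  exact (hind.of_comp_iff (f := k) |>.1 Topology.IsInducing.subtypeVal).topologicalKrullDim_le

theorem AffinePoint.le_topologicalKrullDim_of_zeroLocus_subset (I : Ideal B)
    (S : Set (AffinePoint K B)) (h : ∀ x : AffinePoint K B, (∀ f ∈ I, x f = 0) → x ∈ S) :
    ringKrullDim (B ⧸ I) ≤ topologicalKrullDim S := by
  rw [← AffinePoint.topologicalKrullDim_eq (K := K) (B := B ⧸ I)]
  have hind := AffinePoint.isInducing_comp_of_surjective (Ideal.Quotient.mkₐ K I)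
    (Ideal.Quotient.mkₐ_surjective K I)
  refine (hind.codRestrict (s := S) fun y => h _ fun f hf => ?_).topologicalKrullDim_le
  exact (congrArg y.toAlgHom (Ideal.Quotient.eq_zero_iff_mem.2 hf)).trans (map_zero y.toAlgHom)

end SubsetDimension

/-! ### The center of a monoid of corank one -/

section Center

variable {K A : Type*} [Field K] [CommRing A] [Algebra K A] [Algebra.FiniteType K A]
  [Monoid (AffinePoint K A)]

/-- The closure of (the image of) a torus of dimension `m` in the group of units is irreducible of
dimension `m`. Here `T` is a torus with coordinates `e`, and `ψ` maps the coordinates of the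
smaller torus to coordinates on `T`. -/
theorem exists_prime_of_torus [Infinite K] {r m : ℕ} {T : Subgroup (AffinePoint K A)ˣ}
    (e : (Fin r → Kˣ) ≃* T)
    (he : ∀ f : A, (fun t => ((e t : (AffinePoint K A)ˣ) : AffinePoint K A) f) ∈
      laurentFunctions K r)
    (he' : ∀ i : Fin r, IsRegularOnSubgroup T (fun g => ((e.symm g i : Kˣ) : K)))
    (ψ : (Fin m → Kˣ) → (Fin r → Kˣ)) (hψ1 : ψ 1 = 1)
    (hψ : ∀ i, (fun s => ((ψ s i : Kˣ) : K)) ∈ laurentFunctions K m)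
    (hψ' : ∀ i, (fun s => (((ψ s i)⁻¹ : Kˣ) : K)) ∈ laurentFunctions K m)
    (hpow : ∀ j : Fin m, ∃ (i : Fin r) (n : ℕ), n ≠ 0 ∧ ∀ s, ψ s i = s j ^ n) :
    ∃ Q : Ideal A, Q.IsPrime ∧
      (∀ f, f ∈ Q ↔ ∀ s, ((e (ψ s) : (AffinePoint K A)ˣ) : AffinePoint K A) f = 0) ∧
      ringKrullDim (A ⧸ Q) = m := by
  let ev : A →ₐ[K] laurentFunctions K m :=
    AlgHom.codRestrict
      (AlgHom.pi (R := K) (A := fun _ : Fin m → Kˣ => K)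
        fun s => ((e (ψ s) : (AffinePoint K A)ˣ) : AffinePoint K A).toAlgHom)
      (laurentFunctions K m) fun f => comp_mem_laurentFunctions ψ hψ hψ' (he f)
  have hev : ∀ f s, (ev f).1 s = ((e (ψ s) : (AffinePoint K A)ˣ) : AffinePoint K A) f :=
    fun _ _ => rfl
  have hdim := laurentFunctions.ringKrullDim_range ev fun j => by
    obtain ⟨i, n, hn, hi⟩ := hpow j
    obtain ⟨a, b, hb, hab⟩ := he' i 1
    -- multiplying by `b` removes the condition that `b` does not vanish
    refine ⟨n, hn, a * b, b * b, fun h0 => ?_, Subtype.ext (funext fun s => ?_)⟩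
    · have h1 : (ev (b * b)).1 1 = 0 := congrFun (congrArg Subtype.val h0) 1
      rw [hev, hψ1, map_one] at h1
      exact mul_ne_zero hb hb ((map_mul _ b b).symm.trans h1)
    · change (ev (b * b)).1 s * ((s j : Kˣ) : K) ^ n = (ev (a * b)).1 s
      rw [hev, hev]
      set y : AffinePoint K A := ((e (ψ s) : (AffinePoint K A)ˣ) : AffinePoint K A) with hy
      have h2 : y (b * b) = y b * y b := map_mul y.toAlgHom b b
      have h3 : y (a * b) = y a * y b := map_mul y.toAlgHom a b
      rw [h2, h3]
      by_cases h0 : y b = 0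
      · rw [h0]
        ring
      · have h4 : (((e.symm (e (ψ s)) i : Kˣ) : K)) = y a / y b := hab (e (ψ s)) h0
        rw [MulEquiv.symm_apply_apply, hi, Units.val_pow_eq_pow_val, eq_div_iff h0] at h4
        linear_combination y b * h4
  refine ⟨RingHom.ker ev, RingHom.ker_isPrime ev, fun f => ?_, ?_⟩
  · rw [RingHom.mem_ker]
    exact ⟨fun h s => (hev f s).symm.trans (congrFun (congrArg Subtype.val h) s),
      fun h => Subtype.ext (funext h)⟩
  · rw [← hdim]
    exact ringKrullDim_eq_of_ringEquiv (Ideal.quotientKerEquivRange ev).toRingEquiv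

/-- A parametrization of a torus of dimension one less in the kernel of a nontrivial character. -/
theorem exists_torus_in_ker_torusCharacter {m : ℕ} {n : Fin (m + 1) → ℤ} {i₀ : Fin (m + 1)}
    (hn : n i₀ ≠ 0) : ∃ ψ : (Fin m → Kˣ) → (Fin (m + 1) → Kˣ), ψ 1 = 1 ∧
      (∀ i, (fun s => ((ψ s i : Kˣ) : K)) ∈ laurentFunctions K m) ∧
      (∀ i, (fun s => (((ψ s i)⁻¹ : Kˣ) : K)) ∈ laurentFunctions K m) ∧
      (∀ j : Fin m, ∃ (i : Fin (m + 1)) (k : ℕ), k ≠ 0 ∧ ∀ s, ψ s i = s j ^ k) ∧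
      ∀ s, torusCharacter K n (ψ s) = 1 := by
  have hmono : ∀ a : Fin m → ℤ,
      (fun s : Fin m → Kˣ => ((∏ j, s j ^ a j : Kˣ) : K)) ∈ laurentFunctions K m := by
    intro a
    have : (fun s : Fin m → Kˣ => ((∏ j, s j ^ a j : Kˣ) : K)) =
        ∏ j, fun s : Fin m → Kˣ => ((s j ^ a j : Kˣ) : K) := by
      funext s
      rw [Finset.prod_apply, Units.coe_prod]
    rw [this]
    refine (laurentFunctions K m).prod_mem fun j _ => ?_
    obtain ⟨k, hk | hk⟩ := (a j).eq_nat_or_neg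
    · rw [hk]
      convert (laurentFunctions K m).pow_mem (torusCoord K j).2 k using 1
      funext s
      simp [torusCoord]
    · rw [hk]
      convert (laurentFunctions K m).pow_mem (inv_coord_mem_laurentFunctions j) k using 1
      funext s
      simp
  -- the coordinate functions are monomials with exponents `a i j`
  let N := (n i₀).natAbs
  let ε := (n i₀).sign
  have hεN : n i₀ = ε * N := (Int.sign_mul_natAbs _).symm
  have hεε : ε * ε = 1 := by
    rcases Int.lt_or_gt_of_ne hn with h | h
    · simp [ε, Int.sign_eq_neg_one_of_neg h]
    · simp [ε, Int.sign_eq_one_of_pos h]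
  let a : Fin (m + 1) → Fin m → ℤ :=
    i₀.insertNth (fun j => -ε * n (i₀.succAbove j)) (fun j => Pi.single j (N : ℤ))
  have ha : ∀ (s : Fin m → Kˣ) j, ∏ j', s j' ^ a (i₀.succAbove j) j' = s j ^ N := by
    intro s j
    rw [Finset.prod_eq_single j]
    · simp [a]
    · intro j' _ hj'
      simp [a, hj']
    · simp
  refine ⟨fun s i => ∏ j, s j ^ a i j, ?_, fun i => hmono (a i), fun i => ?_, fun j => ?_, ?_⟩
  · funext i
    simp
  · have h := hmono (-a i)
    convert! h using 3 with s
    simp [Finset.prod_inv_distrib]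
  · exact ⟨i₀.succAbove j, N, Int.natAbs_ne_zero.2 hn, fun s => ha s j⟩
  · intro s
    change ((∏ i, (∏ j, s j ^ a i j) ^ n i : Kˣ) : K) = 1
    rw [Fin.prod_univ_succAbove _ i₀]
    simp only [ha]
    rw [← Finset.prod_zpow, ← Finset.prod_mul_distrib, Finset.prod_eq_one, Units.val_one]
    intro j _
    have h0 : a i₀ j = -ε * n (i₀.succAbove j) := by simp [a]
    rw [h0, hεN, ← zpow_natCast, ← zpow_mul, ← zpow_mul, ← zpow_add]
    have : -ε * n (i₀.succAbove j) * (ε * N) + N * n (i₀.succAbove j) = 0 := by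
      linear_combination (-(n (i₀.succAbove j) * N)) * hεε
    rw [this, zpow_zero]

end Center

/-- A prime of codimension one has height one. -/
theorem Ideal.eq_of_le_of_ringKrullDim_quotient {R : Type*} [CommRing R] [IsDomain R] {r : ℕ}
    {P : Ideal R} [P.IsPrime] (hR : ringKrullDim R = ((r + 1 : ℕ) : WithBot ℕ∞))
    (hP : ringKrullDim (R ⧸ P) = (r : WithBot ℕ∞)) {Q : Ideal R} [Q.IsPrime] (hQP : Q ≤ P)
    (hQ : Q ≠ ⊥) : Q = P := by
  by_contra hne
  obtain ⟨x, hx, hx0⟩ := Submodule.exists_mem_ne_zero_of_ne_bot hQ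
  obtain ⟨y, hy, hyQ⟩ := Set.exists_of_ssubset (SetLike.coe_ssubset_coe.2 (lt_of_le_of_ne hQP hne))
  have h1 : ringKrullDim (R ⧸ Q) + 1 ≤ ringKrullDim R :=
    ringKrullDim_succ_le_of_surjective (Ideal.Quotient.mk Q) Ideal.Quotient.mk_surjective
      (mem_nonZeroDivisors_of_ne_zero hx0) (Ideal.Quotient.eq_zero_iff_mem.2 hx)
  have h2 : ringKrullDim (R ⧸ P) + 1 ≤ ringKrullDim (R ⧸ Q) :=
    ringKrullDim_succ_le_of_surjective (Ideal.Quotient.factor hQP)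
      (Ideal.Quotient.factor_surjective hQP) (r := Ideal.Quotient.mk Q y)
      (mem_nonZeroDivisors_of_ne_zero (Ideal.Quotient.eq_zero_iff_mem.not.2 hyQ))
      (by rw [Ideal.Quotient.factor_mk]; exact Ideal.Quotient.eq_zero_iff_mem.2 hy)
  have h3 := (add_le_add_left h2 1).trans h1
  rw [hP, hR] at h3
  have h4 : r + 1 + 1 ≤ r + 1 := by exact_mod_cast h3
  lia

section CorankOne

variable {K A : Type*} [Field K] [IsAlgClosed K] [CommRing A] [Algebra K A]
  [Algebra.FiniteType K A] [IsDomain A] [Monoid (AffinePoint K A)]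

/-- The set of zeros of the functions `x ↦ f (y * x) - f (x * y)` is the center. -/
theorem MulIsMorphism.central_iff (hmul : MulIsMorphism K A) (x : AffinePoint K A) :
    (∀ y, x * y = y * x) ↔
      ∀ y f, x (hmul.lTranslate y f - hmul.rTranslate y f) = 0 := by
  have h : ∀ y f, x (hmul.lTranslate y f - hmul.rTranslate y f) = (y * x) f - (x * y) f :=
    fun y f => (map_sub x.toAlgHom _ _).trans
      (congrArg₂ _ (hmul.apply_lTranslate y x f) (hmul.apply_rTranslate y x f))
  simp only [h, sub_eq_zero]
  exact ⟨fun hx y f => by rw [hx], fun hx y => AffinePoint.ext fun f => (hx y f).symm⟩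

/-- If the torus acts by conjugation with a local parameter of nontrivial weight, then the center
lies in the closure of the torus and has codimension one there. -/
theorem MulIsMorphism.topologicalKrullDim_center [CharZero K] (hmul : MulIsMorphism K A) {r : ℕ}
    {T : Subgroup (AffinePoint K A)ˣ} (e : (Fin r → Kˣ) ≃* T)
    (he : ∀ f : A, (fun t => ((e t : (AffinePoint K A)ˣ) : AffinePoint K A) f) ∈
      laurentFunctions K r)
    (he' : ∀ i : Fin r, IsRegularOnSubgroup T (fun g => ((e.symm g i : Kˣ) : K)))
    {P : Ideal A} [P.IsPrime] [IsDiscreteValuationRing (Localization.AtPrime P)]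
    (hP : ∀ f, f ∈ P ↔ ∀ t, (T.subtype.comp e.toMonoidHom t : AffinePoint K A) f = 0)
    (hdim : ringKrullDim (A ⧸ P) = (r : WithBot ℕ∞)) {n : Fin r → ℤ} {f : A}
    (hf : IsUniformizerAt P f)
    (hχ : hmul.IsWeightVector (T.subtype.comp e.toMonoidHom) (torusCharacter K n) f)
    (hn : torusCharacter K n ≠ 1) :
    ∃ m : ℕ, r = m + 1 ∧
      topologicalKrullDim {x : AffinePoint K A // ∀ y : AffinePoint K A, x * y = y * x} =
        ((m : ℕ) : WithBot ℕ∞) := by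
  obtain ⟨i₀, hi₀⟩ : ∃ i, n i ≠ 0 := by
    by_contra! h
    exact hn ((congrArg _ (funext h)).trans torusCharacter_zero)
  obtain ⟨m, rfl⟩ : ∃ m, r = m + 1 := ⟨r - 1, by have := i₀.2; lia⟩
  set e' := T.subtype.comp e.toMonoidHom with he'_def
  have he'' : ∀ f : A, (fun t => (e' t : AffinePoint K A) f) ∈ laurentFunctions K (m + 1) := he
  have hpow : ∀ {ψ : (Fin (m + 1) → Kˣ) →* K} {g : A}, g ≠ 0 → hmul.IsWeightVector e' ψ g →
      ∃ k, HasOrder P f g k ∧ ψ = torusCharacter K n ^ k := fun hg hψ => by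
    obtain ⟨k, hk⟩ := hf.exists_hasOrder hg
    exact ⟨k, hk, hψ.eq_pow e' hP hf hχ hk⟩
  let Z : Set (AffinePoint K A) := {x | ∀ y : AffinePoint K A, x * y = y * x}
  refine ⟨m, rfl, le_antisymm ?_ ?_⟩
  · -- the weight components of functions in `P` have nontrivial weights, so vanish on the center
    have hPZ : ∀ x ∈ Z, ∀ g ∈ P, x g = 0 := by
      intro x hx g hg
      obtain ⟨c, hc, hsum⟩ := hmul.exists_weight_decomposition e' he'' g
      rw [hsum]
      refine (map_sum x.toAlgHom _ _).trans (Finset.sum_eq_zero fun ψ hψ => ?_)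
      have hψP : c ψ ∈ P := MulIsMorphism.weight_component_mem e' hP (fun ψ hψ => (hc ψ hψ).2)
        (hsum ▸ hg) hψ
      obtain ⟨k, hk, hk'⟩ := hpow (Finsupp.mem_support_iff.1 hψ) (hc ψ hψ).2
      have hψ1 : ψ ≠ 1 := hk' ▸ torusCharacter_pow_ne_one hn (hk.pos_of_mem hψP).ne'
      obtain ⟨t, ht⟩ := DFunLike.ne_iff.1 hψ1
      have h1 := hmul.apply_conj_of_commute (hx (e' t)).symm (c ψ)
      rw [(hc ψ hψ).2 t] at h1
      have h2 : ψ t * x (c ψ) = x (c ψ) := (map_smul x.toAlgHom _ _).symm.trans h1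
      by_contra h0
      exact ht ((mul_eq_right₀ h0).1 h2)
    obtain ⟨y, h, hyh⟩ : ∃ y h, hmul.lTranslate y h - hmul.rTranslate y h ∉ P := by
      by_contra! hall
      obtain ⟨t, ht⟩ := DFunLike.ne_iff.1 hn
      have hf0 : f ≠ 0 := by
        rintro rfl
        exact hf.ne_zero (map_zero _)
      have h1 : hmul.conj (e' t) f = f := (AffinePoint.funext_iff (K := K)).2 fun x =>
        hmul.apply_conj_of_commute
          ((hmul.central_iff _).2 (fun y h => (hP _).1 (hall y h) t) x) f
      rw [hχ t] at h1
      have h2 : (torusCharacter K n t - 1) • f = 0 := by rw [sub_smul, h1, one_smul, sub_self]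
      exact ht (sub_eq_zero.1 ((smul_eq_zero.1 h2).resolve_right hf0))
    set q := hmul.lTranslate y h - hmul.rTranslate y h with hq
    have hle : P ≤ P ⊔ Ideal.span {q} := le_sup_left
    have h1 : topologicalKrullDim Z ≤ ringKrullDim (A ⧸ (P ⊔ Ideal.span {q})) := by
      refine AffinePoint.topologicalKrullDim_le_of_vanish _ _ fun x hx g hg => ?_
      have hk : P ⊔ Ideal.span {q} ≤ RingHom.ker x.toAlgHom :=
        sup_le (fun g hg => hPZ x hx g hg) ((Ideal.span_singleton_le_iff_mem _).2
          ((hmul.central_iff x).1 hx y h))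
      exact hk hg
    have h2 : ringKrullDim (A ⧸ (P ⊔ Ideal.span {q})) + 1 ≤ ringKrullDim (A ⧸ P) :=
      ringKrullDim_succ_le_of_surjective (Ideal.Quotient.factor hle)
        (Ideal.Quotient.factor_surjective hle) (r := Ideal.Quotient.mk P q)
        (mem_nonZeroDivisors_of_ne_zero (Ideal.Quotient.eq_zero_iff_mem.not.2 hyh))
        (by
          rw [Ideal.Quotient.factor_mk]
          exact Ideal.Quotient.eq_zero_iff_mem.2
            (le_sup_right (a := P) (Ideal.mem_span_singleton_self q)))
    have h3 := (add_le_add_left h1 1).trans h2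
    rw [hdim, Nat.cast_add, Nat.cast_one] at h3
    exact ENat.WithBot.add_le_add_one_right_iff.1 h3
  · -- all weights are powers of the weight of `f`, so its kernel is central
    obtain ⟨ψ, hψ1, hψ, hψ', hψpow, hker⟩ := exists_torus_in_ker_torusCharacter (K := K) hi₀
    obtain ⟨Q, -, hQ, hQdim⟩ := exists_prime_of_torus e he he' ψ hψ1 hψ hψ' hψpow
    have hcentral : ∀ s x, (e' (ψ s) : AffinePoint K A) * x = x * e' (ψ s) := by
      intro s
      refine hmul.commute_of_conj_eq fun g => ?_
      obtain ⟨c, hc, hsum⟩ := hmul.exists_weight_decomposition e' he'' g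
      rw [hsum, map_sum]
      refine Finset.sum_congr rfl fun χ hχ => ?_
      obtain ⟨k, -, hk⟩ := hpow (Finsupp.mem_support_iff.1 hχ) (hc χ hχ).2
      rw [(hc χ hχ).2, hk, MonoidHom.pow_apply, hker, one_pow, one_smul]
    rw [← hQdim]
    refine AffinePoint.le_topologicalKrullDim_of_zeroLocus_subset Q Z fun x hx => ?_
    exact (hmul.central_iff x).2 fun y h => hx _ ((hQ _).2 fun s =>
      (hmul.central_iff _).1 (hcentral s) y h)

end CorankOne

theorem corollary7p3 {K A : Type*} [Field K] [IsAlgClosed K] [CharZero K]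
    [CommRing A] [Algebra K A] [Algebra.FiniteType K A] [IsDomain A] [IsIntegrallyClosed A]
    [Monoid (AffinePoint K A)] (hmul : MulIsMorphism K A)
    (hcorank : HasCorank K A 1)
    (hnoncomm : ∃ x y : AffinePoint K A, x * y ≠ y * x) :
    ∃ d : ℕ, topologicalKrullDim (AffinePoint K A) = ((d + 2 : ℕ) : WithBot ℕ∞) ∧
      topologicalKrullDim {x : AffinePoint K A // ∀ y : AffinePoint K A, x * y = y * x} =
        ((d : ℕ) : WithBot ℕ∞) := by
  obtain ⟨r, T, ⟨hT, -⟩, hdim⟩ := hcorank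
  obtain ⟨e, he, he'⟩ := hT.iso
  rw [hmul.topologicalKrullDim_units] at hdim
  have : IsNoetherianRing A := Algebra.FiniteType.isNoetherianRing K A
  obtain ⟨P, hPprime, hP, hPdim⟩ := exists_prime_of_torus e he he' id rfl
    (fun i => (torusCoord K i).2) (fun i => inv_coord_mem_laurentFunctions i)
    (fun j => ⟨j, 1, one_ne_zero, fun s => (pow_one _).symm⟩)
  have hP0 : P ≠ ⊥ := by
    rintro rfl
    rw [ringKrullDim_eq_of_ringEquiv (RingEquiv.quotientBot A), hdim] at hPdim
    have : r + 1 = r := by exact_mod_cast hPdim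
    lia
  have : IsDiscreteValuationRing (Localization.AtPrime P) :=
    isDiscreteValuationRing_localization_of_height_one P hP0 fun Q _ hQP hQ =>
      Ideal.eq_of_le_of_ringKrullDim_quotient hdim hPdim hQP hQ
  obtain ⟨n, f, hf, hχ⟩ := hmul.exists_weightVector_isUniformizerAt
    (T.subtype.comp e.toMonoidHom) he hP
  by_cases hn : torusCharacter K n = 1
  · -- all weights are trivial, so the torus is central
    exfalso
    obtain ⟨x, y, hxy⟩ := hnoncomm
    refine hxy (hmul.commute_of_central_codim_one T P (fun g => ?_) (fun t ht => ?_) x y)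
    · rw [hP]
      exact ⟨fun h t ht => by simpa using h (e.symm ⟨t, ht⟩), fun h s => h _ (e s).2⟩
    · obtain ⟨s, hs⟩ := e.surjective ⟨t, ht⟩
      refine hmul.commute_of_conj_eq fun g => ?_
      obtain ⟨c, hc, hsum⟩ := hmul.exists_weight_decomposition (T.subtype.comp e.toMonoidHom) he g
      have hs' : t = T.subtype.comp e.toMonoidHom s := (congrArg Subtype.val hs).symm
      rw [hsum, map_sum]
      refine Finset.sum_congr rfl fun ψ hψ => ?_
      obtain ⟨k, hk⟩ := hf.exists_hasOrder (Finsupp.mem_support_iff.1 hψ)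
      rw [hs', (hc ψ hψ).2, (hc ψ hψ).2.eq_pow _ hP hf hχ hk, hn, one_pow, MonoidHom.one_apply,
        one_smul]
  · obtain ⟨m, rfl, hm⟩ := hmul.topologicalKrullDim_center e he he' hP hPdim hf hχ hn
    exact ⟨m, by rw [AffinePoint.topologicalKrullDim_eq, hdim], hm⟩
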